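/- Let $n\ge 1$ in types $B_n$ and $C_n$, and $n\ge 2$ in type $D_n$. Let $\epsilon_1,\dots,\epsilon_n$ be the standard basis of $\mathfrak h^*=\mathbb C^n$, and let the simple roots be $\alpha_i=\epsilon_i-\epsilon_{i+1}$ for $i<n$, and $\alpha_n=\epsilon_n$ (type $B_n$), $\alpha_n=2\epsilon_n$ (type $C_n$), $\alpha_n=\epsilon_{n-1}+\epsilon_n$ (type $D_n$). Let $W=\langle s_1,\dots,s_n\rangle$ be the Weyl group, where $s_i$ is the reflection along $\alpha_i$. Identify $W$ with a subgroup of $S_{2n}$ as follows, where $\bar x=2n+1-x$: $s_i=(i,i+1)(\overline{i+1},\bar\imath)$ for $i<n$; $s_n=(n,\bar n)$ in types $B_n,C_n$; $s_n=(n,n+1)(n-1,n)(n+1,n+2)(n,n+1)$ in type $D_n$. Let $l$ be the length function of $W$ with respect to $s_1,\dots,s_n$, and let $W^{P_n}=\{w\in W: w_1<\dots<w_n\}$ be the set of minimal length representatives of $W/\langle s_1,\dots,s_{n-1}\rangle$. For a nonzero commutative ring $R$, the 0-Hecke algebra is the $R$-algebra with basis $(H_w)_{w\in W}$ such that $H_1=1$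 and, for every simple reflection $s$, $H_sH_w=H_{sw}$ if $l(sw)>l(w)$ and $H_sH_w=H_w$ if $l(sw)<l(w)$; in particular $H_s^2=H_s$. For a sequence $\mathbf t=(t_1,\dots,t_m)$ of simple reflections put $H_{\mathbf t}=H_{t_1}\cdots H_{t_m}$. For a sequence $\mathbf s$ of simple reflections, $T(w,\mathbf s)$ is the set of subsequences $\mathbf t$ of $\mathbf s$ with $H_{\mathbf t}=H_w$; subsequences in different positions are regarded as different. For $w\in W^{P_n}$ let $(\lambda_w)_i=w_{n+1-i}-(n+1-i)$, $1\le i\le n$, and let $\lambda'_w$ be the strict partition with parts $\max\{(\lambda_w)_i-(i-1),0\}$ in types $B_n,C_n$ and $\max\{(\lambda_w)_i-i,0\}$ in type $D_n$. The shifted Young diagram $D'_\lambda$ of a strict partition $\lambda$ consists of the boxes $(i,j)$ with $i\le j\le i+\lambda_i-1$. Let $S\subseteq D'_\mu$ and $(i,j)\in S$. If $i<j$ and $(i+1,j),(i,j+1),(i+1,j+1)\in D'_\mu\setminus S$, then an excitation replaces $S$ by $(S\setminus\{(i,j)\})\cup\{(i+1,j+1)\}$ or by $S\cup\{(i+1,j+1)\}$.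 If $i=j$, then: in types $B_n,C_n$, if $(i,i+1),(i+1,i+1)\in D'_\mu\setminus S$, an excitation replaces $S$ by $(S\setminus\{(i,i)\})\cup\{(i+1,i+1)\}$ or by $S\cup\{(i+1,i+1)\}$; in type $D_n$, if $(i,i+1),(i+1,i+1),(i+1,i+2),(i+2,i+2)\in D'_\mu\setminus S$, an excitation replaces $S$ by $(S\setminus\{(i,i)\})\cup\{(i+2,i+2)\}$ or by $S\cup\{(i+2,i+2)\}$. Let $\mathcal E'_\lambda(\mu)$ be the set of excited shifted Young diagrams of $D'_\lambda$ in $D'_\mu$, that is, of the subsets of $D'_\mu$ obtained from the subset $D'_\lambda$ by a (possibly empty) sequence of excitations; it is empty if $D'_\lambda\not\subseteq D'_\mu$. Let $w,v\in W^{P_n}$, $\lambda=\lambda'_w$ and $\mu=\lambda'_v$. Form the tableau $T'_\mu$ by filling the boxes of $D'_\mu$ with simple reflections: in types $B_n,C_n$, box $(i,j)$ is filled with $s_{n+i-j}$; in type $D_n$, box $(i,i)$ is filled with $s_n$ if $i$ is odd and with $s_{n-1}$ if $i$ is even, and box $(i,j)$ with $i<j$ is filled with $s_{n+i-(j+1)}$.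 Let $\mathbf s_v=(s_{i_1},\dots,s_{i_l})$ be the entries of $T'_\mu$ read from right to left in each row, beginning with the bottom row, then the next row up, and so on. For $C\subseteq D'_\mu$ let $\mathbf s_C$ be the subsequence of $\mathbf s_v$ formed by the entries in the boxes of $C$. For $1\le c\le l$ let $r(c)=s_{i_1}s_{i_2}\cdots s_{i_{c-1}}(\alpha_{i_c})$. **Proposition 5.6.** The sequence $\mathbf s_v$ is a reduced decomposition of $v$, and $T(w,\mathbf s_v)=\{\mathbf s_C\mid C\subseteq D'_\mu,\ H_{\mathbf s_C}=H_w\}$. Moreover: (i) $T(w,\mathbf s_v)=\{\mathbf s_C\mid C\in\mathcal E'_\lambda(\mu)\}$. (ii) Let $(i,j)$ be the box of $T'_\mu$ containing $s_{i_c}$, and put $\epsilon_{\bar m}=-\epsilon_m$ for $1\le m\le n$. Then $$B_n:\ r(c)=2^{-\delta_{ij}}\bigl(\epsilon_{v_{n+i+1}}+\epsilon_{v_{n+j+1}}\bigr),\qquad C_n:\ r(c)=\epsilon_{v_{n+i}}+\epsilon_{v_{n+j}},\qquad D_n:\ r(c)=\epsilon_{v_{n+i}}+\epsilon_{v_{n+j+1}},$$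 where in types $C_n$ and $D_n$ the $v_k$ are the entries of $v\in S_{2n}$ and $\bar m=2n+1-m$, while in the formula for type $B_n$ one writes $v$ as the permutation $(v_1,\dots,v_{2n+1})$ of $1,\dots,2n+1$ that fixes the middle point $n+1$ (so the entries $n+1,\dots,2n$ of $v\in S_{2n}$ become $n+2,\dots,2n+1$) and $\bar m=2n+2-m$. -/

import Mathlib

/-! ### The 0-Hecke algebra of a group with a set of generators -/

/-- The length of `g` with respect to the generating set `S`: the least number of factors in an
expression of `g` as a product of elements of `S`. -/
noncomputable def genLength {G : Type*} [Group G] (S : Set G) (g : G) : ℕ :=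
  sInf {k | ∃ l : List G, (∀ s ∈ l, s ∈ S) ∧ l.prod = g ∧ l.length = k}

/-- The defining relations of the 0-Hecke algebra on the symbols `H_g`, `g ∈ G`. -/
inductive ZeroHeckeRel (R : Type*) [CommRing R] {G : Type*} [Group G] (S : Set G) :
    FreeAlgebra R G → FreeAlgebra R G → Prop
  | one : ZeroHeckeRel R S (FreeAlgebra.ι R 1) 1
  | up (s g : G) (hs : s ∈ S) (h : genLength S g < genLength S (s * g)) :
      ZeroHeckeRel R S (FreeAlgebra.ι R s * FreeAlgebra.ι R g) (FreeAlgebra.ι R (s * g))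
  | down (s g : G) (hs : s ∈ S) (h : genLength S (s * g) < genLength S g) :
      ZeroHeckeRel R S (FreeAlgebra.ι R s * FreeAlgebra.ι R g) (FreeAlgebra.ι R g)
  | sq (s : G) (hs : s ∈ S) :
      ZeroHeckeRel R S (FreeAlgebra.ι R s * FreeAlgebra.ι R s) (FreeAlgebra.ι R s)

/-- The 0-Hecke algebra over `R`: the `R`-algebra generated by `H_g`, `g ∈ G`, subject to
`H_1 = 1`, `H_s H_g = H_{sg}` if `l(sg) > l(g)`, `H_s H_g = H_g` if `l(sg) < l(g)`, and
`H_s ^ 2 = H_s`, for `s ∈ S` and `g ∈ G`. -/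
abbrev ZeroHecke (R : Type*) [CommRing R] {G : Type*} [Group G] (S : Set G) :=
  RingQuot (ZeroHeckeRel R S)

/-- The element `H_g` of the 0-Hecke algebra. -/
noncomputable def heckeH (R : Type*) [CommRing R] {G : Type*} [Group G] (S : Set G) (g : G) :
    ZeroHecke R S :=
  RingQuot.mkAlgHom R (ZeroHeckeRel R S) (FreeAlgebra.ι R g)

/-- `H_t = H_{s_{c_1}} ⋯ H_{s_{c_m}}` for the subsequence `t` of `(s_1, …, s_l)` formed by the
entries in the positions `c_1 < ⋯ < c_m`. A subsequence is given by its set of positions, so that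
subsequences in different positions count as different even if they have the same entries. -/
noncomputable def heckeSubword (R : Type*) [CommRing R] {G : Type*} [Group G] (S : Set G)
    {l : ℕ} (s : Fin l → G) (t : Finset (Fin l)) : ZeroHecke R S :=
  (((List.finRange l).filter (fun c => c ∈ t)).map (fun c => heckeH R S (s c))).prod

/-- The set `T(w, s)` of the subsequences `t` of `s = (s_1, …, s_l)` with `H_t = H_w`. -/
def heckeSubwords (R : Type*) [CommRing R] {G : Type*} [Group G] (S : Set G)
    {l : ℕ} (w : G) (s : Fin l → G) : Set (Finset (Fin l)) :=
  {t | heckeSubword R S s t = heckeH R S w}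

/-! ### Weyl groups of types B, C, D as groups of permutations of `1, …, 2n`

Boxes, indices and the entries of permutations are natural numbers counted from 1. -/

/-- The three types of groups considered. -/
inductive BCDType
  | B
  | C
  | D

/-- The transposition `(a, b)` in the symmetric group on `1, …, N`; the point `k` is the element
`k - 1` of `Fin N`. -/
def transp (N a b : ℕ) : Equiv.Perm (Fin N) :=
  if h : (1 ≤ a ∧ a ≤ N) ∧ (1 ≤ b ∧ b ≤ N) then
    Equiv.swap ⟨a - 1, by omega⟩ ⟨b - 1, by omega⟩
  else 1

/-- The entry `w_k` of the one-line notation `(w_1, …, w_N)` of a permutation of `1, …, N`. -/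
def oneLine {N : ℕ} (w : Equiv.Perm (Fin N)) (k : ℕ) : ℕ :=
  if h : 1 ≤ k ∧ k ≤ N then (w ⟨k - 1, by omega⟩ : ℕ) + 1 else 0

/-- The simple reflection `s_i`, `1 ≤ i ≤ n`, as a permutation of `1, …, 2n`, where
`x̄ = 2n + 1 - x`: for `i < n` it is `(i, i+1)(\bar{i+1}, \bar{i})`, while `s_n` is `(n, n+1)` in
types B and C, and `(n, n+1)(n-1, n)(n+1, n+2)(n, n+1)` in type D. -/
def simplePerm (X : BCDType) (n i : ℕ) : Equiv.Perm (Fin (2 * n)) :=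
  if i = n then
    match X with
    | .B => transp (2 * n) n (n + 1)
    | .C => transp (2 * n) n (n + 1)
    | .D => transp (2 * n) n (n + 1) * transp (2 * n) (n - 1) n *
        transp (2 * n) (n + 1) (n + 2) * transp (2 * n) n (n + 1)
  else transp (2 * n) i (i + 1) * transp (2 * n) (2 * n + 1 - (i + 1)) (2 * n + 1 - i)

/-- The Weyl group `W = ⟨s_1, …, s_n⟩`. -/
def weylGroup (X : BCDType) (n : ℕ) : Subgroup (Equiv.Perm (Fin (2 * n))) :=
  Subgroup.closure (simplePerm X n '' Set.Icc 1 n)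

/-- The simple reflection `s_i`, `1 ≤ i ≤ n`, as an element of `W`. -/
def simpleRefl (X : BCDType) (n i : ℕ) : weylGroup X n :=
  if h : 1 ≤ i ∧ i ≤ n then
    ⟨simplePerm X n i, Subgroup.subset_closure ⟨i, h, rfl⟩⟩
  else 1

/-- The set of simple reflections of `W`. -/
def simpleRefls (X : BCDType) (n : ℕ) : Set (weylGroup X n) :=
  simpleRefl X n '' Set.Icc 1 n

/-- The set `W^{P_n} = {w ∈ W | w_1 < ⋯ < w_n}` of minimal length representatives of the cosets of
`W_{P_n} = ⟨s_1, …, s_{n-1}⟩` in `W`. -/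
def minCosetReps (X : BCDType) (n : ℕ) : Set (weylGroup X n) :=
  {w | ∀ k, 1 ≤ k → k < n → oneLine w.1 k < oneLine w.1 (k + 1)}

/-- In type B, the one-line notation `(v_1, …, v_{2n+1})` of `v` as a permutation of
`1, …, 2n+1`: the middle point `n + 1` is fixed, and the entries `n+1, …, 2n` of `v` become
`n+2, …, 2n+1`. -/
def oneLineOdd {n : ℕ} (v : Equiv.Perm (Fin (2 * n))) (k : ℕ) : ℕ :=
  let shift : ℕ → ℕ := fun x => if x ≤ n then x else x + 1
  if k ≤ n then shift (oneLine v k)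
  else if k = n + 1 then n + 1
  else shift (oneLine v (k - 1))

/-! ### Roots -/

/-- The functional `ε_k`, `1 ≤ k ≤ n`, in `𝔥^*`, which is the complex vector space with basis
`ε_1, …, ε_n`; it is zero for other `k`. -/
noncomputable def epsBasis (n k : ℕ) : Fin n → ℂ :=
  if h : 1 ≤ k ∧ k ≤ n then Pi.single ⟨k - 1, by omega⟩ 1 else 0

/-- The extension of `ε` to `1, …, N`, `N ∈ {2n, 2n+1}`, by `ε_{\bar m} = -ε_m` for `1 ≤ m ≤ n`,
where `\bar m = N + 1 - m`. (The middle index `n + 1`, if `N = 2n + 1`, is sent to zero.) -/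
noncomputable def eps (n N k : ℕ) : Fin n → ℂ :=
  if k ≤ n then epsBasis n k else -epsBasis n (N + 1 - k)

/-- The simple root `α_i`, `1 ≤ i ≤ n`. -/
noncomputable def simpleRoot (X : BCDType) (n i : ℕ) : Fin n → ℂ :=
  if i = n then
    match X with
    | .B => epsBasis n n
    | .C => (2 : ℂ) • epsBasis n n
    | .D => epsBasis n (n - 1) + epsBasis n n
  else epsBasis n i - epsBasis n (i + 1)

/-- The action of the simple reflection `s_i` on `𝔥^*`: the reflection along `α_i` with respect to
the symmetric bilinear form for which `ε_1, …, ε_n` are orthonormal. -/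
noncomputable def reflRoot (X : BCDType) (n i : ℕ) (x : Fin n → ℂ) : Fin n → ℂ :=
  x - (2 * (x ⬝ᵥ simpleRoot X n i) / (simpleRoot X n i ⬝ᵥ simpleRoot X n i)) • simpleRoot X n i

/-- `r(c) = s_{i_1} s_{i_2} ⋯ s_{i_{c-1}} (α_{i_c})` for the sequence `(s_{i_1}, …, s_{i_l})`. -/
noncomputable def rootSeq (X : BCDType) (n : ℕ) {l : ℕ} (idx : Fin l → ℕ) (c : Fin l) :
    Fin n → ℂ :=
  ((List.ofFn idx).take c).foldr (reflRoot X n) (simpleRoot X n (idx c))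

/-! ### Strict partitions, shifted diagrams and excitations -/

/-- The parts `(λ_w)_i = w_{n+1-i} - (n+1-i)`, `1 ≤ i ≤ n`, of the partition of `w`. (The
subtraction does not truncate for `w_1 < ⋯ < w_n`.) -/
def partOf {n : ℕ} (w : Equiv.Perm (Fin (2 * n))) (i : ℕ) : ℕ :=
  oneLine w (n + 1 - i) - (n + 1 - i)

/-- The parts, for `1 ≤ i ≤ n`, of the strict partition `λ'_w`: `max {(λ_w)_i - (i-1), 0}` in types
B and C, and `max {(λ_w)_i - i, 0}` in type D. (Natural number subtraction truncates at zero.) -/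
def strictPart (X : BCDType) {n : ℕ} (w : Equiv.Perm (Fin (2 * n))) (i : ℕ) : ℕ :=
  match X with
  | .B => partOf w i - (i - 1)
  | .C => partOf w i - (i - 1)
  | .D => partOf w i - i

/-- The boxes `(i, j)`, `1 ≤ i ≤ n`, `i ≤ j ≤ i + μ_i - 1`, of the shifted diagram `D'_μ`, read
from right to left in each row, beginning with the bottom row, then the next row up, etc. -/
def readBoxes (n : ℕ) (μ : ℕ → ℕ) : List (ℕ × ℕ) :=
  (List.range n).reverse.flatMap fun a =>
    (List.range (μ (a + 1))).reverse.map fun b => (a + 1, a + 1 + b)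

/-- The shifted Young diagram `D'_μ`: row `i` has `μ_i` boxes, the leftmost one in column `i`. -/
def shiftedDiagram (n : ℕ) (μ : ℕ → ℕ) : Finset (ℕ × ℕ) :=
  (readBoxes n μ).toFinset

/-- `Excitation X D S S'`: the subset `S'` of the shifted diagram `D` arises from the subset `S` by
one excitation of type 1 (a box moves) or of type 2 (a box is added). -/
inductive Excitation (X : BCDType) (D : Finset (ℕ × ℕ)) :
    Finset (ℕ × ℕ) → Finset (ℕ × ℕ) → Prop
  | offDiag1 (S : Finset (ℕ × ℕ)) (i j : ℕ) (hij : i < j) (hS : (i, j) ∈ S)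
      (h1 : (i + 1, j) ∈ D \ S) (h2 : (i, j + 1) ∈ D \ S) (h3 : (i + 1, j + 1) ∈ D \ S) :
      Excitation X D S (insert (i + 1, j + 1) (S.erase (i, j)))
  | offDiag2 (S : Finset (ℕ × ℕ)) (i j : ℕ) (hij : i < j) (hS : (i, j) ∈ S)
      (h1 : (i + 1, j) ∈ D \ S) (h2 : (i, j + 1) ∈ D \ S) (h3 : (i + 1, j + 1) ∈ D \ S) :
      Excitation X D S (insert (i + 1, j + 1) S)
  | diagBC1 (S : Finset (ℕ × ℕ)) (i : ℕ) (hX : X = .B ∨ X = .C) (hS : (i, i) ∈ S)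
      (h1 : (i, i + 1) ∈ D \ S) (h2 : (i + 1, i + 1) ∈ D \ S) :
      Excitation X D S (insert (i + 1, i + 1) (S.erase (i, i)))
  | diagBC2 (S : Finset (ℕ × ℕ)) (i : ℕ) (hX : X = .B ∨ X = .C) (hS : (i, i) ∈ S)
      (h1 : (i, i + 1) ∈ D \ S) (h2 : (i + 1, i + 1) ∈ D \ S) :
      Excitation X D S (insert (i + 1, i + 1) S)
  | diagD1 (S : Finset (ℕ × ℕ)) (i : ℕ) (hX : X = .D) (hS : (i, i) ∈ S)
      (h1 : (i, i + 1) ∈ D \ S) (h2 : (i + 1, i + 1) ∈ D \ S)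
      (h3 : (i + 1, i + 2) ∈ D \ S) (h4 : (i + 2, i + 2) ∈ D \ S) :
      Excitation X D S (insert (i + 2, i + 2) (S.erase (i, i)))
  | diagD2 (S : Finset (ℕ × ℕ)) (i : ℕ) (hX : X = .D) (hS : (i, i) ∈ S)
      (h1 : (i, i + 1) ∈ D \ S) (h2 : (i + 1, i + 1) ∈ D \ S)
      (h3 : (i + 1, i + 2) ∈ D \ S) (h4 : (i + 2, i + 2) ∈ D \ S) :
      Excitation X D S (insert (i + 2, i + 2) S)

/-- The set of excited shifted Young diagrams of `D'_lam` in `D'_μ`: the subsets of `D'_μ` obtained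
from the subset `D'_lam` by a sequence of excitations. There is none if `D'_lam` is not contained
in `D'_μ`. -/
def excitedDiagrams (X : BCDType) (n : ℕ) (lam μ : ℕ → ℕ) : Set (Finset (ℕ × ℕ)) :=
  {C | shiftedDiagram n lam ⊆ shiftedDiagram n μ ∧
    Relation.ReflTransGen (Excitation X (shiftedDiagram n μ)) (shiftedDiagram n lam) C}

/-! ### The reflection-valued shifted tableau and its reading word -/

/-- The index of the simple reflection in box `(i, j)` of the tableau `T'_μ`: it is `n + i - j` in
types B and C. In type D it is `n` or `n - 1` in box `(i, i)` for `i` odd or even, respectively, and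
`n + i - (j + 1)` in box `(i, j)` with `i < j`. -/
def tabEntry (X : BCDType) (n : ℕ) (b : ℕ × ℕ) : ℕ :=
  match X with
  | .B => n + b.1 - b.2
  | .C => n + b.1 - b.2
  | .D => if b.1 = b.2 then (if Odd b.1 then n else n - 1) else n + b.1 - (b.2 + 1)

/-- The number `l` of boxes of `D'_μ`, for `μ = λ'_v`. -/
abbrev wordLen (X : BCDType) {n : ℕ} (v : weylGroup X n) : ℕ :=
  (readBoxes n (strictPart X v.1)).length

/-- The `c`-th box of `D'_μ` in the reading order, for `μ = λ'_v`. -/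
def wordBox (X : BCDType) {n : ℕ} (v : weylGroup X n) (c : Fin (wordLen X v)) : ℕ × ℕ :=
  (readBoxes n (strictPart X v.1)).get c

/-- The indices `(i_1, …, i_l)` of the sequence `s_v = (s_{i_1}, …, s_{i_l})` of the entries of
`T'_μ` in the reading order, for `μ = λ'_v`. -/
def wordIdx (X : BCDType) {n : ℕ} (v : weylGroup X n) (c : Fin (wordLen X v)) : ℕ :=
  tabEntry X n (wordBox X v c)

/-- The sequence `s_v = (s_{i_1}, …, s_{i_l})` of simple reflections. -/
def word (X : BCDType) {n : ℕ} (v : weylGroup X n) (c : Fin (wordLen X v)) : weylGroup X n :=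
  simpleRefl X n (wordIdx X v c)

/-- The subsequence `s_C` of `s_v` of the entries that lie in the boxes in `C`. -/
def subwordOf (X : BCDType) {n : ℕ} (v : weylGroup X n) (C : Finset (ℕ × ℕ)) :
    Finset (Fin (wordLen X v)) :=
  Finset.univ.filter fun c => wordBox X v c ∈ C

/-- The explicit value of `r(c)` for the box `(i, j)` containing `s_{i_c}`. In type B, `v` is written
as a permutation of `1, …, 2n+1`, in types C and D as a permutation of `1, …, 2n`. -/
noncomputable def rootOfBox (X : BCDType) {n : ℕ} (v : weylGroup X n) (b : ℕ × ℕ) : Fin n → ℂ :=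
  match X with
  | .B => (if b.1 = b.2 then (2⁻¹ : ℂ) else 1) •
      (eps n (2 * n + 1) (oneLineOdd v.1 (n + b.1 + 1)) +
        eps n (2 * n + 1) (oneLineOdd v.1 (n + b.2 + 1)))
  | .C => eps n (2 * n) (oneLine v.1 (n + b.1)) + eps n (2 * n) (oneLine v.1 (n + b.2))
  | .D => eps n (2 * n) (oneLine v.1 (n + b.1)) + eps n (2 * n) (oneLine v.1 (n + b.2 + 1))

/-! The three types are treated at once. Counting points from zero, put `e_y = ε_{y+1}` for `y < n`
and `e_y = -e_{2n-1-y}` otherwise; every simple root is a positive multiple of `e_a - e_i` with `a =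
lowerIndex X n i`, and `s_i` swaps `a` with `i` and their reversals. The signs of the roots `g α_j`
give the exchange condition (`signSystem`), hence a 0-Hecke monoid acting on `W` by `demL`. Since
`demL` commutes with right multiplication `demR`, the elements `H_w` are pairwise distinct
(`heckeH_injective`), and an equation `H_t = H_w` becomes an equation of Demazure products in `W`.

An element of `W^{P_n}` is determined by its heads, the values at the first `n` positions. The
number of heads `≥ n + d + X.shift` is the number of boxes of content `j - i = d` in its shifted
diagram. Left multiplication by a simple reflection whose lower point is a head and whose upper
point is not adds one box of the matching content (`headCount_simpleRefl_mul`, `IsDiagramOf.cons`);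
in the opposite case the reflection is absorbed. If both or neither are heads, the Demazure product
leaves `W^{P_n}`, and it never returns.

The reading word is multiplied out from its right end, so boxes are added row by row from the top
and from left to right. Each suffix is a shifted diagram, so the word is reduced
(`isDiagramOf_suffix`).

For (i), an excitation moves or copies a reflection along the word past reflections commuting with
it, which together with `H_s ^ 2 = H_s` preserves the product (`heckeWord_excitation`). Conversely,
suppose that `C` has product `H_w`, and take the first box, in the order of multiplication, that
does not extend the diagram in its own place. The head counts show that this box arises from the
diagonally preceding place by an excitation (`isDiagramOf_or_excitation`). Undoing it lowers the sum
of the row numbers, so the process ends, necessarily at `D'_λ`.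

For (ii), write `v = k u`, where `u` is the product of the suffix starting at the box `(i, j)`. The
simple root of the box is a multiple of `e_x + e_y` with `x` and `y` not heads of `u`; head counts
locate their positions in `u`, and applying `k` gives the entries of `v` at these positions. -/

/-! ### Groups with a sign function on simple roots -/

/-- `P g j` says that `g` maps the `j`-th simple root to a positive root. The conditions are what is
needed for the exchange property. -/
structure SignSystem {ι G : Type*} [Group G] (s : ι → G) (P : G → ι → Prop) : Prop where
  gen : Subgroup.closure (Set.range s) = ⊤
  one : ∀ j, P 1 j
  mul_self : ∀ j, s j * s j = 1
  flip : ∀ g j, P (g * s j) j ↔ ¬ P g j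
  exch : ∀ g i j, P g j → ¬ P (s i * g) j → s i * g = g * s j

theorem genLength_le {G : Type*} [Group G] {S : Set G} (l : List G) (hl : ∀ s ∈ l, s ∈ S) :
    genLength S l.prod ≤ l.length :=
  Nat.sInf_le ⟨l, hl, rfl, rfl⟩

@[simp] theorem genLength_one {G : Type*} [Group G] (S : Set G) : genLength S (1 : G) = 0 :=
  Nat.le_zero.1 (genLength_le (S := S) [] (by simp))

theorem heckeH_one (R : Type*) [CommRing R] {G : Type*} [Group G] (S : Set G) :
    heckeH R S 1 = 1 := by
  rw [heckeH, RingQuot.mkAlgHom_rel R (.one), map_one]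

theorem heckeH_sq (R : Type*) [CommRing R] {G : Type*} [Group G] {S : Set G} {s : G}
    (hs : s ∈ S) : heckeH R S s * heckeH R S s = heckeH R S s := by
  simp only [heckeH]
  rw [← map_mul]
  exact RingQuot.mkAlgHom_rel R (.sq _ hs)

/-- The left multiplication of the 0-Hecke monoid. -/
noncomputable def demL {G : Type*} [Group G] (S : Set G) (s g : G) : G :=
  if genLength S g < genLength S (s * g) then s * g else g

/-- The right multiplication of the 0-Hecke monoid. -/
noncomputable def demR {G : Type*} [Group G] (S : Set G) (t g : G) : G :=
  if genLength S g < genLength S (g * t) then g * t else g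

namespace SignSystem

variable {ι G : Type*} [Group G] {s : ι → G} {P : G → ι → Prop} (h : SignSystem s P)
include h

theorem inv_eq (j : ι) : (s j)⁻¹ = s j := inv_eq_of_mul_eq_one_right (h.mul_self j)

theorem mul_cancel_left (j : ι) (g : G) : s j * (s j * g) = g := by
  rw [← mul_assoc, h.mul_self, one_mul]

theorem mul_cancel_right (j : ι) (g : G) : g * s j * s j = g := by
  rw [mul_assoc, h.mul_self, mul_one]

theorem exists_word (g : G) : ∃ l : List G, (∀ x ∈ l, x ∈ Set.range s) ∧ l.prod = g := by
  have hg : g ∈ Subgroup.closure (Set.range s) := by rw [h.gen]; trivial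
  induction hg using Subgroup.closure_induction with
  | mem x hx => exact ⟨[x], by simpa using hx, by simp⟩
  | one => exact ⟨[], by simp, rfl⟩
  | mul x y _ _ hx hy =>
    obtain ⟨l, hl, rfl⟩ := hx
    obtain ⟨m, hm, rfl⟩ := hy
    exact ⟨l ++ m, by grind, by simp⟩
  | inv x _ hx =>
    obtain ⟨l, hl, rfl⟩ := hx
    refine ⟨(l.map (·⁻¹)).reverse, ?_, (List.prod_inv_reverse l).symm⟩
    intro x hx
    simp only [List.mem_reverse, List.mem_map] at hx
    obtain ⟨y, hy, rfl⟩ := hx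
    obtain ⟨j, rfl⟩ := hl y hy
    exact ⟨j, (h.inv_eq j).symm⟩

theorem exists_reduced (g : G) : ∃ l : List G, (∀ x ∈ l, x ∈ Set.range s) ∧ l.prod = g ∧
    l.length = genLength (Set.range s) g := by
  obtain ⟨l, hl, hg⟩ := h.exists_word g
  exact Nat.sInf_mem (s := {k | ∃ l : List G, (∀ x ∈ l, x ∈ Set.range s) ∧ l.prod = g ∧
    l.length = k}) ⟨l.length, l, hl, hg, rfl⟩

theorem genLength_inv (g : G) : genLength (Set.range s) g⁻¹ = genLength (Set.range s) g := by
  have key : ∀ g : G, genLength (Set.range s) g⁻¹ ≤ genLength (Set.range s) g := by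
    intro g
    obtain ⟨l, hl, rfl, hlen⟩ := h.exists_reduced g
    rw [← hlen, List.prod_inv_reverse]
    refine (genLength_le _ ?_).trans (by simp)
    intro x hx
    simp only [List.mem_reverse, List.mem_map] at hx
    obtain ⟨y, hy, rfl⟩ := hx
    obtain ⟨j, rfl⟩ := hl y hy
    exact ⟨j, (h.inv_eq j).symm⟩
  exact le_antisymm (key g) (by simpa using key g⁻¹)

/-! ### Length, the exchange condition and the sign criterion -/

theorem genLength_mul_le (i : ι) (g : G) :
    genLength (Set.range s) (s i * g) ≤ genLength (Set.range s) g + 1 := by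
  obtain ⟨l, hl, rfl, hlen⟩ := h.exists_reduced g
  rw [← hlen, ← List.prod_cons]
  exact genLength_le _ (by simpa using hl)

/-- The empty suffix of the word has positive sign at `j` and the whole word negative sign. At the
letter where the sign changes, `exch` turns that letter into a factor `s j` on the right of the
suffix, so multiplication by `s j` deletes the letter. -/
theorem exchange (j : ι) (l : List G) (hl : ∀ x ∈ l, x ∈ Set.range s) (hP : ¬ P l.prod j) :
    ∃ l' : List G, (∀ x ∈ l', x ∈ Set.range s) ∧ l'.length + 1 = l.length ∧
      l'.prod = l.prod * s j := by
  induction l with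
  | nil => exact absurd (h.one j) hP
  | cons x l ih =>
    obtain ⟨i, rfl⟩ := hl x (by simp)
    have hl' : ∀ x ∈ l, x ∈ Set.range s := fun x hx => hl x (by simp [hx])
    by_cases hq : P l.prod j
    · refine ⟨l, hl', by simp, ?_⟩
      rw [List.prod_cons] at hP ⊢
      rw [h.exch _ i j hq hP, h.mul_cancel_right]
    · obtain ⟨l', h1, h2, h3⟩ := ih hl' hq
      refine ⟨s i :: l', ?_, by simp [h2], by simp [h3, mul_assoc]⟩
      intro x hx
      rcases List.mem_cons.1 hx with rfl | hx
      · exact ⟨i, rfl⟩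
      · exact h1 x hx

theorem genLength_mul_lt {g : G} {j : ι} (hP : ¬ P g j) :
    genLength (Set.range s) (g * s j) < genLength (Set.range s) g := by
  obtain ⟨l, hl, rfl, hlen⟩ := h.exists_reduced g
  obtain ⟨l', h1, h2, h3⟩ := h.exchange j l hl hP
  have := genLength_le l' h1
  rw [h3] at this
  omega

theorem lt_genLength_mul {g : G} {j : ι} (hP : P g j) :
    genLength (Set.range s) g < genLength (Set.range s) (g * s j) := by
  have := h.genLength_mul_lt (g := g * s j) (j := j) (by rw [h.flip]; simpa using hP)
  rwa [h.mul_cancel_right] at this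

theorem lt_right_iff (g : G) (j : ι) :
    genLength (Set.range s) g < genLength (Set.range s) (g * s j) ↔ P g j :=
  ⟨fun hl => by by_contra hP; exact absurd (h.genLength_mul_lt hP) (by omega),
    h.lt_genLength_mul⟩

theorem genLength_inv_mul (g : G) (i : ι) :
    genLength (Set.range s) (s i * g) = genLength (Set.range s) (g⁻¹ * s i) := by
  rw [← h.genLength_inv (s i * g), mul_inv_rev, h.inv_eq]

theorem lt_left_iff (g : G) (i : ι) :
    genLength (Set.range s) g < genLength (Set.range s) (s i * g) ↔ P g⁻¹ i := by
  rw [h.genLength_inv_mul, ← h.genLength_inv g, h.lt_right_iff]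

theorem genLength_left_lt {g : G} {i : ι}
    (hn : ¬ genLength (Set.range s) g < genLength (Set.range s) (s i * g)) :
    genLength (Set.range s) (s i * g) < genLength (Set.range s) g := by
  rw [h.lt_left_iff] at hn
  have := h.genLength_mul_lt hn
  rwa [← h.genLength_inv_mul, h.genLength_inv] at this

/-! ### The two multiplications of the 0-Hecke monoid and the distinctness of the `H_w` -/

theorem demL_eq (g : G) (i : ι) [Decidable (P g⁻¹ i)] :
    demL (Set.range s) (s i) g = if P g⁻¹ i then s i * g else g := by
  simp only [demL, h.lt_left_iff]

theorem demR_eq (g : G) (j : ι) [Decidable (P g j)] :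
    demR (Set.range s) (s j) g = if P g j then g * s j else g := by
  simp only [demR, h.lt_right_iff]

theorem sign_left {g : G} {i j : ι} (hne : s i * g ≠ g * s j) : P (s i * g) j ↔ P g j := by
  constructor
  · intro h1
    by_contra h2
    have := h.exch (s i * g) i j h1 (by rwa [h.mul_cancel_left])
    rw [mul_assoc] at this
    exact hne (mul_left_cancel this)
  · intro h1
    by_contra h2
    exact hne (h.exch g i j h1 h2)

/-- If `s i * g = g * s j`, both operations send `g` to the longer of `g` and `s i * g`, and
repeating them changes nothing. Otherwise, by `sign_left`, multiplying on one side does not affect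
the sign that governs the other side. -/
theorem demL_demR (g : G) (i j : ι) : demL (Set.range s) (s i) (demR (Set.range s) (s j) g) =
    demR (Set.range s) (s j) (demL (Set.range s) (s i) g) := by
  classical
  by_cases he : s i * g = g * s j
  · have e1 : s i * (g * s j) = g := by rw [← he, h.mul_cancel_left]
    unfold demL demR
    rw [← he]
    split_ifs with h1 h2 <;> simp_all [h.mul_cancel_right]; omega
  · have h1 := h.sign_left he
    have h2 : P (s j * g⁻¹) i ↔ P g⁻¹ i := by
      apply h.sign_left
      intro h3
      apply he
      have : g * (s j * g⁻¹) * g = g * (g⁻¹ * s i) * g := by rw [h3]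
      simpa [mul_assoc] using this.symm
    rw [h.demR_eq, h.demL_eq g]
    by_cases ha : P g j <;> by_cases hb : P g⁻¹ i <;>
      simp only [ha, hb, if_true, if_false, h.demL_eq, h.demR_eq, mul_inv_rev, h.inv_eq, h1, h2,
        mul_assoc]

theorem exists_right_descent {g : G} (hg : g ≠ 1) : ∃ j,
    genLength (Set.range s) (g * s j) < genLength (Set.range s) g := by
  obtain ⟨l, hl, rfl, hlen⟩ := h.exists_reduced g
  rcases List.eq_nil_or_concat l with rfl | ⟨l', x, rfl⟩
  · exact absurd rfl hg
  · obtain ⟨j, rfl⟩ := hl x (by simp)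
    refine ⟨j, ?_⟩
    rw [← hlen]
    have := genLength_le (S := Set.range s) l' (fun x hx => hl x (by simp [hx]))
    simp only [List.concat_eq_append, List.prod_append, List.prod_singleton, h.mul_cancel_right,
      List.length_append, List.length_singleton]
    omega

theorem exists_left_descent {g : G} (hg : g ≠ 1) : ∃ i,
    genLength (Set.range s) (s i * g) < genLength (Set.range s) g := by
  obtain ⟨j, hj⟩ := h.exists_right_descent (inv_ne_one.2 hg)
  exact ⟨j, by rwa [h.genLength_inv_mul, ← h.genLength_inv g]⟩

/-- Every element is reached from `1` by right multiplications that increase the length, so the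
value at `1` propagates. -/
theorem demR_commuting_unique {f f' : G → G}
    (hf : ∀ j x, f (demR (Set.range s) (s j) x) = demR (Set.range s) (s j) (f x))
    (hf' : ∀ j x, f' (demR (Set.range s) (s j) x) = demR (Set.range s) (s j) (f' x))
    (h1 : f 1 = f' 1) : f = f' := by
  funext x
  induction hk : genLength (Set.range s) x using Nat.strong_induction_on generalizing x with
  | _ k ih =>
    by_cases hx : x = 1
    · rw [hx, h1]
    · obtain ⟨j, hj⟩ := h.exists_right_descent hx
      have e : x = demR (Set.range s) (s j) (x * s j) := by
        rw [demR, h.mul_cancel_right, if_pos hj]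
      rw [e, hf, hf', ih _ (hk ▸ hj) _ rfl]

/-- The map is the composite of the operators `demL` along a reduced word of `g`. -/
theorem exists_demR_commuting (g : G) : ∃ f : Function.End G,
    (∀ j x, f (demR (Set.range s) (s j) x) = demR (Set.range s) (s j) (f x)) ∧ f 1 = g := by
  induction hk : genLength (Set.range s) g using Nat.strong_induction_on generalizing g with
  | _ k ih =>
    by_cases hx : g = 1
    · exact ⟨id, fun _ _ => rfl, hx.symm⟩
    · obtain ⟨i, hi⟩ := h.exists_left_descent hx
      obtain ⟨f, hf, hf1⟩ := ih _ (hk ▸ hi) _ rfl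
      refine ⟨fun x => demL (Set.range s) (s i) (f x), fun j x => ?_, ?_⟩
      · simp only [hf, h.demL_demR]
      · simp only [hf1]
        rw [demL, h.mul_cancel_left, if_pos hi]

variable (R : Type*) [CommRing R]

/-- The maps `D g` commuting with right multiplication, with `D g 1 = g`, give a representation of
the 0-Hecke algebra in the monoid algebra of `Function.End G`. Each defining relation holds because
both sides commute with `demR` and agree at `1`. Over a nontrivial `R` the monoid embeds in its
algebra, and evaluation at `1` recovers `g`. -/
theorem heckeH_injective [Nontrivial R] : Function.Injective (heckeH R (Set.range s)) := by
  choose D hD hD1 using h.exists_demR_commuting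
  have uniq : ∀ {f f' : Function.End G},
      (∀ j x, f (demR (Set.range s) (s j) x) = demR (Set.range s) (s j) (f x)) →
      (∀ j x, f' (demR (Set.range s) (s j) x) = demR (Set.range s) (s j) (f' x)) →
      f 1 = f' 1 → f = f' := fun a b c => h.demR_commuting_unique a b c
  have hmul : ∀ g g', ∀ j x, (D g * D g') (demR (Set.range s) (s j) x) =
      demR (Set.range s) (s j) ((D g * D g') x) := by
    intro g g' j x
    change D g (D g' _) = demR _ _ (D g (D g' x))
    rw [hD, hD]
  have hs : ∀ i, D (s i) = (fun x => demL (Set.range s) (s i) x : Function.End G) := by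
    intro i
    refine uniq (hD _) (fun j x => h.demL_demR x i j) ?_
    rw [hD1]
    classical
    rw [h.demL_eq, inv_one, if_pos (h.one i), mul_one]
  have hmul1 : ∀ i g, (D (s i) * D g) 1 = demL (Set.range s) (s i) g := by
    intro i g
    change D (s i) (D g 1) = _
    rw [hD1, hs]
  let φ : FreeAlgebra R G →ₐ[R] MonoidAlgebra R (Function.End G) :=
    FreeAlgebra.lift R fun g => MonoidAlgebra.of R (Function.End G) (D g)
  have hφ : ∀ ⦃x y⦄, ZeroHeckeRel R (Set.range s) x y → φ x = φ y := by
    intro x y hxy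
    induction hxy with
    | one =>
      simp only [φ, FreeAlgebra.lift_ι_apply, map_one]
      rw [uniq (f := D 1) (f' := 1) (hD 1) (fun _ _ => rfl) (hD1 1), map_one]
    | up t g ht hl =>
      obtain ⟨i, rfl⟩ := ht
      simp only [φ, FreeAlgebra.lift_ι_apply, map_mul]
      rw [← map_mul]
      congr 1
      refine uniq (hmul _ _) (hD _) ?_
      rw [hmul1, hD1, demL, if_pos hl]
    | down t g ht hl =>
      obtain ⟨i, rfl⟩ := ht
      simp only [φ, FreeAlgebra.lift_ι_apply, map_mul]
      rw [← map_mul]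
      congr 1
      refine uniq (hmul _ _) (hD _) ?_
      rw [hmul1, hD1, demL, if_neg hl.not_gt]
    | sq t ht =>
      obtain ⟨i, rfl⟩ := ht
      simp only [φ, FreeAlgebra.lift_ι_apply, map_mul]
      rw [← map_mul]
      congr 1
      refine uniq (hmul _ _) (hD _) ?_
      rw [hmul1, hD1, demL, h.mul_self, genLength_one, if_neg (by omega)]
  intro g g' he
  have h2 := congrArg (RingQuot.liftAlgHom R ⟨φ, hφ⟩) he
  simp only [heckeH, RingQuot.liftAlgHom_mkAlgHom_apply, φ, FreeAlgebra.lift_ι_apply] at h2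
  have h3 := MonoidAlgebra.of_injective h2
  rw [← hD1 g, h3, hD1]

theorem heckeH_mul (i : ι) (g : G) : heckeH R (Set.range s) (s i) * heckeH R (Set.range s) g =
    heckeH R (Set.range s) (demL (Set.range s) (s i) g) := by
  unfold demL
  simp only [heckeH]
  rw [← map_mul]
  split_ifs with hl
  · exact RingQuot.mkAlgHom_rel R (.up _ _ ⟨i, rfl⟩ hl)
  · exact RingQuot.mkAlgHom_rel R (.down _ _ ⟨i, rfl⟩ (h.genLength_left_lt hl))

theorem heckeH_commute {i j : ι} (hc : s i * s j = s j * s i) :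
    Commute (heckeH R (Set.range s) (s i)) (heckeH R (Set.range s) (s j)) := by
  classical
  by_cases he : s i = s j
  · rw [he]
  · have key : ∀ i j, s i ≠ s j → s i * s j = s j * s i →
        heckeH R (Set.range s) (s i) * heckeH R (Set.range s) (s j) =
          heckeH R (Set.range s) (s i * s j) := by
      intro i j he hc
      rw [h.heckeH_mul, h.demL_eq, h.inv_eq, if_pos]
      -- If `s i * s j` were not longer than `s j`, `exch` would force `s i = s j`.
      by_contra hP
      have := h.exch 1 j i (h.one i) (by rwa [mul_one])
      rw [mul_one, one_mul] at this
      exact he this.symm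
    rw [Commute, SemiconjBy, key i j he hc, key j i (Ne.symm he) hc.symm, hc]

end SignSystem

/-! ### The simple reflections as signed permutations -/

/-- The shift between types B, C and type D. -/
def BCDType.shift : BCDType → ℕ
  | .B => 0
  | .C => 0
  | .D => 1

theorem BCDType.shift_le (X : BCDType) : X.shift ≤ 1 := by cases X <;> simp [BCDType.shift]

theorem BCDType.shift_eq_one {X : BCDType} : X.shift = 1 ↔ X = .D := by
  cases X <;> simp [BCDType.shift]

theorem BCDType.shift_eq_zero {X : BCDType} : X.shift = 0 ↔ X = .B ∨ X = .C := by
  cases X <;> simp [BCDType.shift]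

/-- Counted from zero, the simple root `α_i` is the difference `e_a - e_i` with
`a = lowerIndex X n i`, where `e_{\bar x} = -e_x`. -/
def lowerIndex (X : BCDType) (n i : ℕ) : ℕ := if i = n then n - 1 - X.shift else i - 1

/-- The simple reflection `s_i` as a function on `0, …, 2n - 1`. -/
def simpleVal (X : BCDType) (n i x : ℕ) : ℕ :=
  if x = lowerIndex X n i then i
  else if x = i then lowerIndex X n i
  else if x = 2 * n - 1 - lowerIndex X n i then 2 * n - 1 - i
  else if x = 2 * n - 1 - i then 2 * n - 1 - lowerIndex X n i
  else x

theorem transp_val {N a b : ℕ} (ha : 1 ≤ a) (ha' : a ≤ N) (hb : 1 ≤ b) (hb' : b ≤ N)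
    (x : Fin N) : (transp N a b x : ℕ) =
      if (x : ℕ) = a - 1 then b - 1 else if (x : ℕ) = b - 1 then a - 1 else x := by
  rw [transp, dif_pos ⟨⟨ha, ha'⟩, hb, hb'⟩, Equiv.swap_apply_def]
  simp only [Fin.ext_iff]
  split_ifs <;> rfl

theorem lowerIndex_lt {X : BCDType} {n i : ℕ} (hn : X.shift < n) (hi : 1 ≤ i) :
    lowerIndex X n i < i := by
  unfold lowerIndex
  split_ifs <;> omega

/-- For `i = n` in types B and C the two swaps in `simpleVal` coincide. In type D the four
transpositions are a conjugate of a product of two, equal to `(n-2, n)(n-1, n+1)` when counted from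
zero. -/
theorem simplePerm_val {X : BCDType} {n i : ℕ} (hn : X.shift < n) (hi : 1 ≤ i) (hi' : i ≤ n)
    (x : Fin (2 * n)) : (simplePerm X n i x : ℕ) = simpleVal X n i x := by
  have hx := x.2
  unfold simplePerm simpleVal lowerIndex
  by_cases h : i = n
  · subst h
    cases X
    · simp only [if_true, BCDType.shift]
      rw [transp_val (by omega) (by omega) (by omega) (by omega)]
      split_ifs <;> omega
    · simp only [if_true, BCDType.shift]
      rw [transp_val (by omega) (by omega) (by omega) (by omega)]
      split_ifs <;> omega
    · simp only [BCDType.shift] at hn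
      simp only [if_true, BCDType.shift, Equiv.Perm.mul_apply]
      rw [transp_val (by omega) (by omega) (by omega) (by omega),
        transp_val (by omega) (by omega) (by omega) (by omega),
        transp_val (by omega) (by omega) (by omega) (by omega),
        transp_val (by omega) (by omega) (by omega) (by omega)]
      grind
  · simp only [if_neg h, Equiv.Perm.mul_apply]
    rw [transp_val (by omega) (by omega) (by omega) (by omega),
      transp_val (by omega) (by omega) (by omega) (by omega)]
    grind

theorem simpleVal_lt {X : BCDType} {n i x : ℕ} (hn : X.shift < n) (hi : 1 ≤ i) (hi' : i ≤ n)
    (hx : x < 2 * n) : simpleVal X n i x < 2 * n := by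
  have := lowerIndex_lt hn hi
  unfold simpleVal
  split_ifs <;> omega

theorem simpleVal_simpleVal {X : BCDType} {n i x : ℕ} (hn : X.shift < n) (hi : 1 ≤ i)
    (hi' : i ≤ n) : simpleVal X n i (simpleVal X n i x) = x := by
  unfold simpleVal lowerIndex
  have := X.shift_le
  by_cases h : i = n
  · simp only [h, if_true]
    grind
  · simp only [h, if_false]
    grind

theorem simpleVal_rev {X : BCDType} {n i x : ℕ} (hn : X.shift < n) (hi : 1 ≤ i)
    (hi' : i ≤ n) (hx : x < 2 * n) :
    simpleVal X n i (2 * n - 1 - x) = 2 * n - 1 - simpleVal X n i x := by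
  unfold simpleVal lowerIndex
  have := X.shift_le
  by_cases h : i = n
  · simp only [h, if_true]
    grind
  · simp only [h, if_false]
    grind

/-- A simple reflection makes only its own positive root negative; the two alternatives are the two
ways to write that root as a difference of points. Pairs with sum `2n - 1` represent `2ε_k`, which
is not a root in type D, and there `s_n` does invert two of them. -/
theorem simpleVal_lt_iff {X : BCDType} {n i x y : ℕ} (hn : X.shift < n) (hi : 1 ≤ i)
    (hi' : i ≤ n) (hxy : x < y) (hD : X = .D → x + y ≠ 2 * n - 1)
    (hs : ¬ simpleVal X n i x < simpleVal X n i y) :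
    x = lowerIndex X n i ∧ y = i ∨
      x = 2 * n - 1 - i ∧ y = 2 * n - 1 - lowerIndex X n i := by
  unfold simpleVal lowerIndex at *
  have hD' : X.shift = 1 → x + y ≠ 2 * n - 1 := fun h => hD (BCDType.shift_eq_one.1 h)
  have := X.shift_le
  by_cases h : i = n
  · simp only [h, if_true] at *
    grind
  · simp only [h, if_false] at *
    grind

/-! ### The Weyl group has the exchange property -/

theorem simpleRefl_val {X : BCDType} {n i : ℕ} (hi : 1 ≤ i) (hi' : i ≤ n) :
    (simpleRefl X n i).1 = simplePerm X n i := by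
  rw [simpleRefl, dif_pos ⟨hi, hi'⟩]

theorem simpleRefl_mul_val {X : BCDType} {n i : ℕ} (hn : X.shift < n) (hi : 1 ≤ i) (hi' : i ≤ n)
    (u : weylGroup X n) (x : Fin (2 * n)) :
    ((simpleRefl X n i * u).1 x : ℕ) = simpleVal X n i (u.1 x) := by
  rw [Subgroup.coe_mul, Equiv.Perm.mul_apply, simpleRefl_val hi hi', simplePerm_val hn hi hi']

theorem simpleRefl_mul_self {X : BCDType} {n i : ℕ} (hn : X.shift < n) (hi : 1 ≤ i)
    (hi' : i ≤ n) : simpleRefl X n i * simpleRefl X n i = 1 := by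
  ext x
  rw [simpleRefl_mul_val hn hi hi', simpleRefl_val hi hi', simplePerm_val hn hi hi',
    simpleVal_simpleVal hn hi hi']
  rfl

theorem closure_simpleRefl (X : BCDType) (n : ℕ) :
    Subgroup.closure (Set.range fun j : Set.Icc 1 n => simpleRefl X n j) = ⊤ := by
  have h := Subgroup.closure_closure_coe_preimage (k := simplePerm X n '' Set.Icc 1 n)
  rw [← top_le_iff]
  refine h.symm.le.trans (Subgroup.closure_mono ?_)
  rintro ⟨x, hx⟩ ⟨i, hi, rfl⟩
  exact ⟨⟨i, hi⟩, Subtype.ext (simpleRefl_val hi.1 hi.2)⟩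

theorem weylGroup_induction {X : BCDType} {n : ℕ} {p : weylGroup X n → Prop}
    (hn : X.shift < n) (h1 : p 1)
    (hs : ∀ i g, 1 ≤ i → i ≤ n → p g → p (simpleRefl X n i * g)) (g : weylGroup X n) : p g := by
  have hg : g ∈ Subgroup.closure (Set.range fun j : Set.Icc 1 n => simpleRefl X n j) := by
    rw [closure_simpleRefl]; trivial
  induction hg using Subgroup.closure_induction_left with
  | one => exact h1
  | mul_left x hx y _ hy =>
    obtain ⟨j, rfl⟩ := hx
    exact hs _ _ j.2.1 j.2.2 hy
  | inv_mul_cancel x hx y _ hy =>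
    obtain ⟨j, rfl⟩ := hx
    simp only
    rw [inv_eq_of_mul_eq_one_right (simpleRefl_mul_self hn j.2.1 j.2.2)]
    exact hs _ _ j.2.1 j.2.2 hy

theorem weylGroup_rev {X : BCDType} {n : ℕ} (hn : X.shift < n) (u : weylGroup X n)
    (x y : Fin (2 * n)) (hxy : (y : ℕ) = 2 * n - 1 - x) : (u.1 y : ℕ) = 2 * n - 1 - u.1 x := by
  induction u using weylGroup_induction hn with
  | h1 => exact hxy
  | hs i g hi hi' ih =>
    rw [simpleRefl_mul_val hn hi hi', simpleRefl_mul_val hn hi hi', ih,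
      simpleVal_rev hn hi hi' (g.1 x).2]

/-- The image of the simple root `α_j` under `g` is positive. -/
def SimplePos (X : BCDType) (n : ℕ) (g : weylGroup X n) (j : Set.Icc 1 n) : Prop :=
  g.1 ⟨lowerIndex X n j, by have := j.2.1; have := j.2.2; unfold lowerIndex; split_ifs <;> omega⟩ <
    g.1 ⟨j, by have := j.2.1; have := j.2.2; omega⟩

theorem simpleVal_lower {X : BCDType} {n i : ℕ} : simpleVal X n i (lowerIndex X n i) = i := by
  simp [simpleVal]

theorem simpleVal_upper {X : BCDType} {n i : ℕ} : simpleVal X n i i = lowerIndex X n i := by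
  unfold simpleVal
  by_cases h : i = lowerIndex X n i
  · rw [if_pos h]
    exact h
  · rw [if_neg h, if_pos rfl]

theorem simpleVal_of_ne {X : BCDType} {n i x : ℕ} (h1 : x ≠ lowerIndex X n i) (h2 : x ≠ i)
    (h3 : x ≠ 2 * n - 1 - lowerIndex X n i) (h4 : x ≠ 2 * n - 1 - i) :
    simpleVal X n i x = x := by
  simp [simpleVal, h1, h2, h3, h4]

theorem mul_simpleRefl_val {X : BCDType} {n i : ℕ} (hn : X.shift < n) (hi : 1 ≤ i) (hi' : i ≤ n)
    (u : weylGroup X n) (x : Fin (2 * n)) :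
    (u * simpleRefl X n i).1 x = u.1 ⟨simpleVal X n i x, simpleVal_lt hn hi hi' x.2⟩ := by
  rw [Subgroup.coe_mul, Equiv.Perm.mul_apply, simpleRefl_val hi hi']
  congr 1
  exact Fin.ext (simplePerm_val hn hi hi' x)

/-- The hypotheses say that `g` carries the moved points of `τ` to those of `σ`, so `σ` is the
conjugate of `τ` by `g`. -/
theorem mul_eq_mul_of_orbit {α : Type*} (σ τ g : Equiv.Perm α) (a b a' b' : α)
    (h1 : τ a = b) (h2 : τ b = a) (h3 : τ a' = b') (h4 : τ b' = a')
    (h5 : ∀ z, z ≠ a → z ≠ b → z ≠ a' → z ≠ b' → τ z = z)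
    (k1 : σ (g a) = g b) (k2 : σ (g b) = g a) (k3 : σ (g a') = g b') (k4 : σ (g b') = g a')
    (k5 : ∀ z, z ≠ g a → z ≠ g b → z ≠ g a' → z ≠ g b' → σ z = z) : σ * g = g * τ := by
  ext z
  simp only [Equiv.Perm.mul_apply]
  by_cases z1 : z = a
  · rw [z1, h1, k1]
  by_cases z2 : z = b
  · rw [z2, h2, k2]
  by_cases z3 : z = a'
  · rw [z3, h3, k3]
  by_cases z4 : z = b'
  · rw [z4, h4, k4]
  rw [h5 z z1 z2 z3 z4, k5] <;> simpa

/-- The action of `s_i` on the points of `Fin (2 * n)`. -/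
theorem simpleRefl_orbit {X : BCDType} {n i : ℕ} (hn : X.shift < n) (hi : 1 ≤ i) (hi' : i ≤ n)
    (a b a' b' : Fin (2 * n)) (ha : (a : ℕ) = lowerIndex X n i) (hb : (b : ℕ) = i)
    (ha' : (a' : ℕ) = 2 * n - 1 - a) (hb' : (b' : ℕ) = 2 * n - 1 - b) :
    (simpleRefl X n i).1 a = b ∧ (simpleRefl X n i).1 b = a ∧ (simpleRefl X n i).1 a' = b' ∧
      (simpleRefl X n i).1 b' = a' ∧
      ∀ z, z ≠ a → z ≠ b → z ≠ a' → z ≠ b' → (simpleRefl X n i).1 z = z := by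
  rw [simpleRefl_val hi hi']
  simp only [Fin.ext_iff, ne_eq, simplePerm_val hn hi hi']
  refine ⟨?_, ?_, ?_, ?_, ?_⟩
  · rw [ha, hb, simpleVal_lower]
  · rw [ha, hb, simpleVal_upper]
  · rw [ha', hb', simpleVal_rev hn hi hi' a.2, ha, hb, simpleVal_lower]
  · rw [ha', hb', simpleVal_rev hn hi hi' b.2, ha, hb, simpleVal_upper]
  · intro z h1 h2 h3 h4
    rw [ha'] at h3
    rw [hb'] at h4
    rw [ha] at h1 h3
    rw [hb] at h2 h4
    exact simpleVal_of_ne h1 h2 h3 h4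

/-- Since `s_i` makes the positive root `g α_j` negative, `g α_j` is proportional to `α_i`, and `g`
conjugates `s_j` to `s_i`. -/
theorem simpleRefl_mul_eq {X : BCDType} {n i j : ℕ} (hn : X.shift < n) (hi1 : 1 ≤ i)
    (hi2 : i ≤ n) (hj1 : 1 ≤ j) (hj2 : j ≤ n) (g : weylGroup X n)
    (hlj : lowerIndex X n j < 2 * n) (hj3 : j < 2 * n)
    (hP : g.1 ⟨lowerIndex X n j, hlj⟩ < g.1 ⟨j, hj3⟩)
    (hN : ¬ (simpleRefl X n i * g).1 ⟨lowerIndex X n j, hlj⟩ <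
      (simpleRefl X n i * g).1 ⟨j, hj3⟩) :
    simpleRefl X n i * g = g * simpleRefl X n j := by
  obtain ⟨a, ha⟩ : ∃ a : Fin (2 * n), a = ⟨lowerIndex X n j, hlj⟩ := ⟨_, rfl⟩
  obtain ⟨b, hb⟩ : ∃ b : Fin (2 * n), b = ⟨j, hj3⟩ := ⟨_, rfl⟩
  obtain ⟨a', ha'⟩ : ∃ a' : Fin (2 * n), (a' : ℕ) = 2 * n - 1 - a := ⟨⟨_, by omega⟩, rfl⟩
  obtain ⟨b', hb'⟩ : ∃ b' : Fin (2 * n), (b' : ℕ) = 2 * n - 1 - b := ⟨⟨_, by omega⟩, rfl⟩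
  have hga' := weylGroup_rev hn g a a' ha'
  have hgb' := weylGroup_rev hn g b b' hb'
  rw [← ha, ← hb, Fin.lt_def] at hP hN
  rw [simpleRefl_mul_val hn hi1 hi2, simpleRefl_mul_val hn hi1 hi2] at hN
  have ha1 : (a : ℕ) = lowerIndex X n j := by rw [ha]
  have hb1 : (b : ℕ) = j := by rw [hb]
  have hD : X = .D → (g.1 a : ℕ) + g.1 b ≠ 2 * n - 1 := by
    intro hX hs
    have h1 : b = a' := g.1.injective (Fin.ext (by rw [hga']; omega))
    have h2 : j = 2 * n - 1 - lowerIndex X n j := by rw [← ha1, ← ha', ← h1, hb1]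
    have hX1 := BCDType.shift_eq_one.2 hX
    unfold lowerIndex at h2
    split_ifs at h2 <;> omega
  have hτ := simpleRefl_orbit hn hj1 hj2 a b a' b' ha1 hb1 ha' hb'
  apply Subtype.ext
  rcases simpleVal_lt_iff hn hi1 hi2 hP hD hN with ⟨e1, e2⟩ | ⟨e1, e2⟩
  · have hσ := simpleRefl_orbit hn hi1 hi2 _ _ _ _ e1 e2 hga' hgb'
    exact mul_eq_mul_of_orbit _ _ _ a b a' b' hτ.1 hτ.2.1 hτ.2.2.1 hτ.2.2.2.1 hτ.2.2.2.2
      hσ.1 hσ.2.1 hσ.2.2.1 hσ.2.2.2.1 hσ.2.2.2.2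
  -- Here `g` carries the pair of `j` to the reversed pair of `i`, so the four points are matched in
  -- reverse order.
  · have hl := lowerIndex_lt hn hi1
    have hσ := simpleRefl_orbit hn hi1 hi2 (g.1 b') (g.1 a') (g.1 b) (g.1 a) (by omega)
      (by omega) (by omega) (by omega)
    exact mul_eq_mul_of_orbit _ _ _ a b a' b' hτ.1 hτ.2.1 hτ.2.2.1 hτ.2.2.2.1 hτ.2.2.2.2
      hσ.2.2.2.1 hσ.2.2.1 hσ.2.1 hσ.1 (fun z h1 h2 h3 h4 => hσ.2.2.2.2 z h4 h3 h2 h1)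

theorem signSystem {X : BCDType} {n : ℕ} (hn : X.shift < n) :
    SignSystem (fun j : Set.Icc 1 n => simpleRefl X n j) (SimplePos X n) where
  gen := closure_simpleRefl X n
  one j := by
    change lowerIndex X n j < j
    exact lowerIndex_lt hn j.2.1
  mul_self j := simpleRefl_mul_self hn j.2.1 j.2.2
  flip g j := by
    obtain ⟨j, hj1, hj2⟩ := j
    unfold SimplePos
    rw [mul_simpleRefl_val hn hj1 hj2, mul_simpleRefl_val hn hj1 hj2]
    simp only [simpleVal_lower, simpleVal_upper]
    refine ⟨fun h => h.not_gt, fun h => lt_of_le_of_ne (not_lt.1 h) fun e => ?_⟩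
    exact (lowerIndex_lt hn hj1).ne' (congrArg Fin.val (g.1.injective e))
  exch g i j hP hN := by
    obtain ⟨i, hi1, hi2⟩ := i
    obtain ⟨j, hj1, hj2⟩ := j
    exact simpleRefl_mul_eq hn hi1 hi2 hj1 hj2 g (by have := lowerIndex_lt hn hj1; omega)
      (by omega) hP hN

theorem simpleRefls_eq (X : BCDType) (n : ℕ) :
    simpleRefls X n = Set.range fun j : Set.Icc 1 n => simpleRefl X n j :=
  Set.image_eq_range _ _

/-! ### The values at the first half of the positions -/

/-- The value `t` is taken by `u` on the first half of the positions. -/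
def IsHead {n : ℕ} (u : Equiv.Perm (Fin (2 * n))) (t : ℕ) : Prop :=
  ∃ x : Fin (2 * n), (x : ℕ) < n ∧ (u x : ℕ) = t

/-- The number of values `≥ t` that `u` takes on the first half of the positions. -/
def headCount {n : ℕ} (u : Equiv.Perm (Fin (2 * n))) (t : ℕ) : ℕ :=
  (Finset.univ.filter fun x : Fin (2 * n) => (x : ℕ) < n ∧ t ≤ (u x : ℕ)).card

theorem headCount_of_not_isHead {n : ℕ} {u : Equiv.Perm (Fin (2 * n))} {t : ℕ}
    (h : ¬ IsHead u t) : headCount u t = headCount u (t + 1) := by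
  unfold headCount
  congr 1
  ext x
  simp only [Finset.mem_filter, Finset.mem_univ, true_and]
  refine ⟨fun hx => ⟨hx.1, ?_⟩, fun hx => ⟨hx.1, by omega⟩⟩
  have : (u x : ℕ) ≠ t := fun e => h ⟨x, hx.1, e⟩
  omega

theorem headCount_of_isHead {n : ℕ} {u : Equiv.Perm (Fin (2 * n))} {t : ℕ}
    (h : IsHead u t) : headCount u t = headCount u (t + 1) + 1 := by
  obtain ⟨y, hy, rfl⟩ := h
  unfold headCount
  rw [← Finset.card_insert_of_notMem (a := y) (by simp)]
  congr 1
  ext x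
  simp only [Finset.mem_filter, Finset.mem_univ, true_and, Finset.mem_insert]
  constructor
  · rintro ⟨h1, h2⟩
    rcases h2.lt_or_eq with h3 | h3
    · exact .inr ⟨h1, h3⟩
    · exact .inl (u.injective (Fin.ext h3.symm))
  · rintro (rfl | ⟨h1, h2⟩)
    · exact ⟨hy, le_rfl⟩
    · exact ⟨h1, by omega⟩

theorem IsHead.lt {n : ℕ} {u : Equiv.Perm (Fin (2 * n))} {t : ℕ} (h : IsHead u t) :
    t < 2 * n := by
  obtain ⟨x, -, rfl⟩ := h
  exact (u x).2

theorem headCount_eq_zero {n : ℕ} (u : Equiv.Perm (Fin (2 * n))) {t : ℕ} (h : 2 * n ≤ t) :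
    headCount u t = 0 := by
  unfold headCount
  rw [Finset.card_eq_zero, Finset.filter_eq_empty_iff]
  intro x _
  have := (u x).2
  omega

/-- Reversal commutes with `u` and exchanges the two halves of the positions. -/
theorem isHead_rev {X : BCDType} {n : ℕ} (hn : X.shift < n) (u : weylGroup X n) {t t' : ℕ}
    (h : t + t' = 2 * n - 1) : IsHead u.1 t ↔ ¬ IsHead u.1 t' := by
  constructor
  · rintro ⟨x, hx, h1⟩ ⟨y, hy, h2⟩
    have h3 := weylGroup_rev hn u x ⟨2 * n - 1 - x, by omega⟩ rfl
    have h4 : y = ⟨2 * n - 1 - x, by omega⟩ := u.1.injective (Fin.ext (by omega))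
    have : (y : ℕ) = 2 * n - 1 - x := by rw [h4]
    omega
  · intro hh
    obtain ⟨x, hx⟩ := u.1.surjective ⟨t, by omega⟩
    by_cases h1 : (x : ℕ) < n
    · exact ⟨x, h1, by rw [hx]⟩
    · have h3 := weylGroup_rev hn u x ⟨2 * n - 1 - x, by omega⟩ rfl
      refine absurd ⟨⟨2 * n - 1 - x, by omega⟩, ?_, ?_⟩ hh
      · simp only
        omega
      · rw [h3, hx]
        simp only
        omega

theorem isHead_mul {X : BCDType} {n i : ℕ} (hn : X.shift < n) (hi : 1 ≤ i) (hi' : i ≤ n)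
    (u : weylGroup X n) (t : ℕ) :
    IsHead (simpleRefl X n i * u).1 t ↔ IsHead u.1 (simpleVal X n i t) := by
  unfold IsHead
  refine exists_congr fun x => and_congr_right fun _ => ?_
  rw [simpleRefl_mul_val hn hi hi']
  constructor
  · rintro rfl
    rw [simpleVal_simpleVal hn hi hi']
  · intro h
    rw [h, simpleVal_simpleVal hn hi hi']

theorem headCount_congr {n m : ℕ} {u u' : Equiv.Perm (Fin (2 * n))} {t : ℕ}
    (h : ∀ k, t ≤ k → k < m → (IsHead u k ↔ IsHead u' k)) (htm : t ≤ m) {c : ℕ}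
    (hm : headCount u m = headCount u' m + c) : headCount u t = headCount u' t + c := by
  induction htm using Nat.decreasingInduction with
  | self => exact hm
  | of_succ k hk ih =>
    have := ih fun l hl => h l (by omega)
    by_cases hh : IsHead u k
    · rw [headCount_of_isHead hh, headCount_of_isHead ((h k le_rfl hk).1 hh)]
      omega
    · rw [headCount_of_not_isHead hh,
        headCount_of_not_isHead (mt (h k le_rfl hk).2 hh)]
      omega

theorem headCount_congr' {n : ℕ} {u u' : Equiv.Perm (Fin (2 * n))} {t : ℕ}
    (h : ∀ k, t ≤ k → (IsHead u k ↔ IsHead u' k)) : headCount u t = headCount u' t := by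
  by_cases ht : t ≤ 2 * n
  · exact headCount_congr (c := 0) (fun k hk _ => h k hk) ht
      (by rw [headCount_eq_zero _ le_rfl, headCount_eq_zero _ le_rfl])
  · rw [headCount_eq_zero _ (by omega), headCount_eq_zero _ (by omega)]

/-- The values from `n - k` to `n + k - 1` form `k` reversal pairs, each containing exactly one
head. -/
theorem headCount_compl {X : BCDType} {n : ℕ} (hn : X.shift < n) (u : weylGroup X n) {k : ℕ}
    (hk : k ≤ n) : headCount u.1 (n - k) = k + headCount u.1 (n + k) := by
  induction k with
  | zero => simp
  | succ k ih =>
    have h1 := ih (by omega)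
    have h2 := isHead_rev hn u (t := n - (k + 1)) (t' := n + k) (by omega)
    have e : n - (k + 1) + 1 = n - k := by omega
    by_cases h : IsHead u.1 (n + k)
    · have h3 := headCount_of_not_isHead (mt h2.1 (not_not.2 h))
      have h4 := headCount_of_isHead h
      rw [e] at h3
      rw [← add_assoc]
      omega
    · have h3 := headCount_of_isHead (h2.2 h)
      have h4 := headCount_of_not_isHead h
      rw [e] at h3
      rw [← add_assoc]
      omega

/-- Elements of type D make an even number of sign changes: `s_n` exchanges the points `n, n+1` with
`n-2, n-1`, and the other generators preserve both halves of the values. -/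
theorem even_headCount {X : BCDType} {n : ℕ} (hn : X.shift < n) (hX : X = .D)
    (u : weylGroup X n) : Even (headCount u.1 n) := by
  have hX1 := BCDType.shift_eq_one.2 hX
  induction u using weylGroup_induction hn with
  | h1 =>
    have h0 : headCount (1 : weylGroup X n).1 n = 0 := by
      unfold headCount
      rw [Finset.card_eq_zero, Finset.filter_eq_empty_iff]
      intro x _
      change ¬ ((x : ℕ) < n ∧ n ≤ (x : ℕ))
      omega
    rw [h0]
    exact Even.zero
  | hs i g hi hi' ih =>
    by_cases hin : i = n
    · subst hin
      have hl : lowerIndex X i i = i - 2 := by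
        unfold lowerIndex
        rw [if_pos rfl, hX1]
        omega
      have hm := isHead_mul hn hi le_rfl g
      have v1 : simpleVal X i i i = i - 2 := by rw [simpleVal_upper, hl]
      have v2 : simpleVal X i i (i + 1) = i - 1 := by
        unfold simpleVal
        rw [hl]
        split_ifs <;> omega
      have h2 : headCount (simpleRefl X i i * g).1 (i + 1 + 1) = headCount g.1 (i + 1 + 1) := by
        apply headCount_congr'
        intro k hk
        rw [hm, simpleVal_of_ne] <;> omega
      have r1 := isHead_rev hn g (t := i - 2) (t' := i + 1) (by omega)
      have r2 := isHead_rev hn g (t := i - 1) (t' := i) (by omega)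
      rw [← v1, ← hm] at r1
      rw [← v2, ← hm] at r2
      revert ih
      by_cases a : IsHead g.1 i <;> by_cases b : IsHead g.1 (i + 1)
      · rw [headCount_of_not_isHead (mt r1.1 (not_not.2 b)),
          headCount_of_not_isHead (mt r2.1 (not_not.2 a)),
          headCount_of_isHead a, headCount_of_isHead b, h2]
        grind
      · rw [headCount_of_isHead (r1.2 b),
          headCount_of_not_isHead (mt r2.1 (not_not.2 a)),
          headCount_of_isHead a, headCount_of_not_isHead b, h2]
        exact id
      · rw [headCount_of_not_isHead (mt r1.1 (not_not.2 b)),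
          headCount_of_isHead (r2.2 a),
          headCount_of_not_isHead a, headCount_of_isHead b, h2]
        exact id
      · rw [headCount_of_isHead (r1.2 b), headCount_of_isHead (r2.2 a),
          headCount_of_not_isHead a, headCount_of_not_isHead b, h2]
        grind
    · convert ih using 1
      unfold headCount
      congr 1
      ext x
      simp only [Finset.mem_filter, Finset.mem_univ, true_and]
      refine and_congr_right fun _ => ?_
      rw [simpleRefl_mul_val hn hi hi']
      unfold simpleVal lowerIndex
      rw [if_neg hin]
      split_ifs <;> omega

/-! ### Minimal coset representatives -/

theorem mem_minCosetReps_iff_simplePos {X : BCDType} {n : ℕ} (u : weylGroup X n) :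
    u ∈ minCosetReps X n ↔ ∀ j : Set.Icc 1 n, (j : ℕ) < n → SimplePos X n u j := by
  have e : ∀ k, 1 ≤ k → ∀ hk : k < n, (oneLine u.1 k < oneLine u.1 (k + 1) ↔
      u.1 ⟨k - 1, by omega⟩ < u.1 ⟨k, by omega⟩) := by
    intro k h1 h2
    rw [oneLine, oneLine, dif_pos (by omega), dif_pos (by omega), Fin.lt_def]
    simp
  have l : ∀ k, k < n → lowerIndex X n k = k - 1 := by
    intro k hk
    rw [lowerIndex, if_neg hk.ne]
  constructor
  · rintro h ⟨j, hj1, hj2⟩ hj3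
    have := (e j hj1 hj3).1 (h j hj1 hj3)
    unfold SimplePos
    simpa only [l j hj3] using this
  · intro h k h1 h2
    have := h ⟨k, h1, h2.le⟩ h2
    unfold SimplePos at this
    simp only [l k h2] at this
    exact (e k h1 h2).2 this

theorem mem_minCosetReps_iff {X : BCDType} {n : ℕ} (u : weylGroup X n) :
    u ∈ minCosetReps X n ↔ ∀ x y : Fin (2 * n), x < y → (y : ℕ) < n → u.1 x < u.1 y := by
  constructor
  · intro h x y hxy hy
    have key : ∀ d, ∀ k (hk : k + d + 1 < n),
        u.1 ⟨k, by omega⟩ < u.1 ⟨k + d + 1, by omega⟩ := by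
      intro d
      induction d with
      | zero =>
        intro k hk
        have := h (k + 1) (by omega) (by omega)
        rw [oneLine, oneLine, dif_pos (by omega), dif_pos (by omega)] at this
        exact Nat.lt_of_add_lt_add_right this
      | succ d ih =>
        intro k hk
        refine (ih k (by omega)).trans ?_
        have := h (k + d + 1 + 1) (by omega) (by omega)
        rw [oneLine, oneLine, dif_pos (by omega), dif_pos (by omega)] at this
        exact Nat.lt_of_add_lt_add_right this
    have hxy' : (x : ℕ) < y := hxy
    have := key (y - x - 1) x (by omega)
    convert this using 2
    apply Fin.ext
    simp only
    omega
  · intro h k h1 h2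
    rw [oneLine, oneLine, dif_pos (by omega), dif_pos (by omega)]
    have := h ⟨k - 1, by omega⟩ ⟨k, by omega⟩ (Fin.mk_lt_mk.2 (by omega)) h2
    exact Nat.add_lt_add_right this 1

/-- As `u` increases on the first half, its heads `≥ t` occupy the last `headCount u t` of the first
`n` positions. -/
theorem headCount_apply {X : BCDType} {n : ℕ} {u : weylGroup X n} (hu : u ∈ minCosetReps X n)
    (x : Fin (2 * n)) (hx : (x : ℕ) < n) (t : ℕ) :
    t ≤ (u.1 x : ℕ) ↔ n ≤ x + headCount u.1 t := by
  rw [mem_minCosetReps_iff] at hu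
  have card : ∀ m, m ≤ n → (Finset.univ.filter fun y : Fin (2 * n) => m ≤ (y : ℕ) ∧
      (y : ℕ) < n).card = n - m := by
    intro m hm
    rw [← Nat.card_Ico, ← Finset.card_map Fin.valEmbedding]
    congr 1
    ext k
    simp only [Finset.mem_map, Finset.mem_filter, Finset.mem_univ, true_and,
      Fin.valEmbedding_apply, Finset.mem_Ico]
    constructor
    · rintro ⟨y, hy, rfl⟩
      exact hy
    · intro hk
      exact ⟨⟨k, by omega⟩, hk, rfl⟩
  constructor
  · intro ht
    have := Finset.card_le_card (s := Finset.univ.filter fun y : Fin (2 * n) => (x : ℕ) ≤ (y : ℕ) ∧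
      (y : ℕ) < n) (t := Finset.univ.filter fun x : Fin (2 * n) => (x : ℕ) < n ∧ t ≤ (u.1 x : ℕ)) (by
        intro y hy
        simp only [Finset.mem_filter, Finset.mem_univ, true_and] at hy ⊢
        refine ⟨hy.2, ?_⟩
        rcases hy.1.lt_or_eq with h | h
        · exact ht.trans (hu x y h hy.2).le
        · rwa [← Fin.ext h])
    rw [card _ hx.le] at this
    unfold headCount
    omega
  · intro hc
    by_contra ht
    have := Finset.card_le_card (s := Finset.univ.filter fun x : Fin (2 * n) => (x : ℕ) < n ∧
      t ≤ (u.1 x : ℕ)) (t := Finset.univ.filter fun y : Fin (2 * n) => (x : ℕ) + 1 ≤ (y : ℕ) ∧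
      (y : ℕ) < n) (by
        intro y hy
        simp only [Finset.mem_filter, Finset.mem_univ, true_and] at hy ⊢
        refine ⟨?_, hy.1⟩
        by_contra hyx
        rcases (show (y : ℕ) ≤ x by omega).lt_or_eq with h | h
        · have := hu y x h hx
          have : (u.1 y : ℕ) < u.1 x := this
          omega
        · rw [Fin.ext h] at hy
          omega)
    rw [card _ hx] at this
    unfold headCount at hc
    omega

theorem headCount_self {X : BCDType} {n : ℕ} {u : weylGroup X n} (hu : u ∈ minCosetReps X n)
    (x : Fin (2 * n)) (hx : (x : ℕ) < n) : x + headCount u.1 (u.1 x) = n := by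
  have h1 := (headCount_apply hu x hx _).1 le_rfl
  have h2 := mt (headCount_apply hu x hx (u.1 x + 1)).2 (by omega)
  rw [headCount_of_isHead ⟨x, hx, rfl⟩] at h1 ⊢
  omega

/-- Reversal moves the position into the first half, where `headCount_self` applies. -/
theorem inv_apply_of_not_isHead {X : BCDType} {n : ℕ} (hn : X.shift < n) {u : weylGroup X n}
    (hu : u ∈ minCosetReps X n) (z : Fin (2 * n)) {y : ℕ} (hy : (u.1 z : ℕ) = y)
    (h : ¬ IsHead u.1 y) : (z : ℕ) + 1 = n + headCount u.1 (2 * n - 1 - y) := by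
  have hz : n ≤ (z : ℕ) := by
    by_contra hz
    exact h ⟨z, by omega, hy⟩
  have h1 := weylGroup_rev hn u z ⟨2 * n - 1 - z, by omega⟩ rfl
  have h2 := headCount_self hu ⟨2 * n - 1 - z, by omega⟩ (by simp only; omega)
  rw [h1, hy] at h2
  simp only at h2
  omega

/-- A minimal coset representative is determined by the numbers of its large values. -/
theorem minCosetReps_ext {X : BCDType} {n : ℕ} (hn : X.shift < n) {u w : weylGroup X n}
    (hu : u ∈ minCosetReps X n) (hw : w ∈ minCosetReps X n)
    (h : ∀ t, n + X.shift ≤ t → headCount u.1 t = headCount w.1 t) : u = w := by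
  have h1 : headCount u.1 n = headCount w.1 n := by
    -- In type D the hypothesis starts at `n + 1`; parity decides whether `n` is a head.
    by_cases hX : X = .D
    · have hX1 := BCDType.shift_eq_one.2 hX
      have e1 := even_headCount hn hX u
      have e2 := even_headCount hn hX w
      have e3 := h (n + 1) (by omega)
      by_cases a : IsHead u.1 n <;> by_cases b : IsHead w.1 n
      · rw [headCount_of_isHead a, headCount_of_isHead b, e3]
      · rw [headCount_of_isHead a] at e1
        rw [headCount_of_not_isHead b] at e2
        grind
      · rw [headCount_of_not_isHead a] at e1
        rw [headCount_of_isHead b] at e2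
        grind
      · rw [headCount_of_not_isHead a, headCount_of_not_isHead b, e3]
    · have hX1 : X.shift = 0 := by
        have := X.shift_le
        have := mt BCDType.shift_eq_one.1 hX
        omega
      exact h n (by omega)
  have h2 : ∀ t, n ≤ t → headCount u.1 t = headCount w.1 t := by
    intro t ht
    have := X.shift_le
    rcases ht.lt_or_eq with h3 | rfl
    · exact h t (by omega)
    · exact h1
  have h3 : ∀ t, headCount u.1 t = headCount w.1 t := by
    intro t
    by_cases ht : n ≤ t
    · exact h2 t ht
    · have := headCount_compl hn u (k := n - t) (by omega)
      have h5 := headCount_compl hn w (k := n - t) (by omega)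
      rw [h2 (n + (n - t)) (by omega)] at this
      rw [show n - (n - t) = t by omega] at this h5
      omega
  have h4 : ∀ x : Fin (2 * n), (x : ℕ) < n → (u.1 x : ℕ) = w.1 x := by
    intro x hx
    apply eq_of_forall_le_iff
    intro t
    rw [headCount_apply hu x hx, headCount_apply hw x hx, h3]
  apply Subtype.ext
  apply Equiv.ext
  intro x
  apply Fin.ext
  by_cases hx : (x : ℕ) < n
  · exact h4 x hx
  · have e : (x : ℕ) = 2 * n - 1 - (⟨2 * n - 1 - x, by omega⟩ : Fin (2 * n)) := by
      simp only
      omega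
    rw [weylGroup_rev hn u _ x e, weylGroup_rev hn w _ x e, h4 _ (by simp only; omega)]

/-! ### Left multiplication of minimal coset representatives by simple reflections -/

theorem isHead_iff_inv {n t : ℕ} (u : Equiv.Perm (Fin (2 * n))) (ht : t < 2 * n) :
    IsHead u t ↔ (u⁻¹ ⟨t, ht⟩ : ℕ) < n := by
  constructor
  · rintro ⟨x, hx, rfl⟩
    simpa using hx
  · intro h
    exact ⟨_, h, by simp⟩

theorem lt_genLength_simpleRefl_mul {X : BCDType} {n i : ℕ} (hn : X.shift < n) (hi : 1 ≤ i)
    (hi' : i ≤ n) {u : weylGroup X n} (h1 : IsHead u.1 (lowerIndex X n i))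
    (h2 : ¬ IsHead u.1 i) :
    genLength (simpleRefls X n) u < genLength (simpleRefls X n) (simpleRefl X n i * u) := by
  rw [simpleRefls_eq, (signSystem hn).lt_left_iff u ⟨i, hi, hi'⟩]
  rw [isHead_iff_inv _ h1.lt] at h1
  rw [isHead_iff_inv _ (by omega)] at h2
  exact Fin.lt_def.2 (h1.trans_le (not_lt.1 h2))

theorem demL_of_not_isHead {X : BCDType} {n i : ℕ} (hn : X.shift < n) (hi : 1 ≤ i)
    (hi' : i ≤ n) {u : weylGroup X n} (h1 : ¬ IsHead u.1 (lowerIndex X n i))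
    (h2 : IsHead u.1 i) : demL (simpleRefls X n) (simpleRefl X n i) u = u := by
  have hl := lowerIndex_lt hn hi
  rw [demL, if_neg]
  rw [simpleRefls_eq, (signSystem hn).lt_left_iff u ⟨i, hi, hi'⟩]
  rw [isHead_iff_inv _ (by omega)] at h1 h2
  intro h
  have h : (u.1⁻¹ ⟨lowerIndex X n i, by omega⟩ : ℕ) < u.1⁻¹ ⟨i, by omega⟩ := h
  omega

/-- The only inversions that `s_i` could create among the heads are the pair of `i` and its
reversal, and neither pair consists of heads. -/
theorem simpleRefl_mul_mem {X : BCDType} {n i : ℕ} (hn : X.shift < n) (hi : 1 ≤ i)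
    (hi' : i ≤ n) {u : weylGroup X n} (hu : u ∈ minCosetReps X n)
    (h1 : IsHead u.1 (lowerIndex X n i)) (h2 : ¬ IsHead u.1 i) :
    simpleRefl X n i * u ∈ minCosetReps X n := by
  rw [mem_minCosetReps_iff] at hu ⊢
  intro x y hxy hy
  have hxy' : (x : ℕ) < y := hxy
  rw [Fin.lt_def, simpleRefl_mul_val hn hi hi', simpleRefl_mul_val hn hi hi']
  by_contra hs
  have hD : X = .D → (u.1 x : ℕ) + u.1 y ≠ 2 * n - 1 := fun _ hsum =>
    (isHead_rev hn u hsum).1 ⟨x, by omega, rfl⟩ ⟨y, hy, rfl⟩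
  rcases simpleVal_lt_iff hn hi hi' (hu x y hxy hy) hD hs with ⟨e1, e2⟩ | ⟨e1, e2⟩
  · exact h2 ⟨y, hy, e2⟩
  · have hl := lowerIndex_lt hn hi
    exact (isHead_rev hn u (t' := 2 * n - 1 - lowerIndex X n i) (by omega)).1 h1 ⟨y, hy, e2⟩

/-- Above the threshold `n + X.shift`, the only change is that the value `2n - 1 - lowerIndex X n i`
becomes a head, in place of `2n - 1 - i`. In type D the count at `n` may rise by two, which is why
the range starts one step later. -/
theorem headCount_simpleRefl_mul {X : BCDType} {n i : ℕ} (hn : X.shift < n) (hi : 1 ≤ i)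
    (hi' : i ≤ n) {u : weylGroup X n} (h1 : IsHead u.1 (lowerIndex X n i))
    (h2 : ¬ IsHead u.1 i) {t : ℕ} (ht : n + X.shift ≤ t) :
    headCount (simpleRefl X n i * u).1 t =
      headCount u.1 t + if t = 2 * n - 1 - lowerIndex X n i then 1 else 0 := by
  have hl := lowerIndex_lt hn hi
  have hs := X.shift_le
  have hl' : lowerIndex X n i + X.shift < n := by
    unfold lowerIndex
    split_ifs <;> omega
  have hi3 : i = n → lowerIndex X n i + X.shift = n - 1 := by
    intro h
    unfold lowerIndex
    rw [if_pos h]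
    omega
  have hi4 : i ≠ n → lowerIndex X n i = i - 1 := fun h => if_neg h
  obtain ⟨a, ha⟩ : ∃ a, a = 2 * n - 1 - lowerIndex X n i := ⟨_, rfl⟩
  have hm := isHead_mul hn hi hi' u
  have fixed : ∀ k, n + X.shift ≤ k → k ≠ a → k ≠ 2 * n - 1 - i →
      (IsHead (simpleRefl X n i * u).1 k ↔ IsHead u.1 k) := by
    intro k hk hk1 hk2
    rw [hm, simpleVal_of_ne] <;> omega
  have r1 := isHead_rev hn u (t := lowerIndex X n i) (t' := a) (by omega)
  have r2 := isHead_rev hn u (t := 2 * n - 1 - i) (t' := i) (by omega)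
  have above : ∀ k, a < k → headCount (simpleRefl X n i * u).1 k = headCount u.1 k :=
    fun k hk => headCount_congr' fun l hl => fixed l (by omega) (by omega) (by omega)
  have v1 : simpleVal X n i a = 2 * n - 1 - i := by
    rw [ha, simpleVal_rev hn hi hi' (by omega), simpleVal_lower]
  have v2 : simpleVal X n i (2 * n - 1 - i) = a := by
    rw [← v1, simpleVal_simpleVal hn hi hi']
  have b1 : IsHead (simpleRefl X n i * u).1 a := by
    rw [hm, v1]
    exact r2.2 h2
  have b2 : ¬ IsHead u.1 a := r1.1 h1
  have at_a : headCount (simpleRefl X n i * u).1 a = headCount u.1 a + 1 := by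
    rw [headCount_of_isHead b1, headCount_of_not_isHead b2, above _ (by omega)]
  rw [← ha]
  split_ifs with hta
  · rw [hta, at_a]
  · by_cases hlt : a < t
    · rw [above t hlt, add_zero]
    -- For `i = n` one has `a = n + X.shift`, so no `t` is left. Otherwise the head moves up by one,
    -- and the counts agree below both values.
    · have e : 2 * n - 1 - i + 1 = a := by
        by_cases h : i = n
        · have := hi3 h
          omega
        · have := hi4 h
          omega
      have c1 : ¬ IsHead (simpleRefl X n i * u).1 (2 * n - 1 - i) := by
        rw [hm, v2]
        exact b2
      have c2 := r2.2 h2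
      refine headCount_congr (m := 2 * n - 1 - i)
        (fun k h1 h2 => fixed k (by omega) (by omega) (by omega)) (by omega) ?_
      rw [headCount_of_isHead c2, headCount_of_not_isHead c1, e, at_a]

/-- Right descents survive left Demazure multiplication: if `s i * u` lost the descent `j`, then
`exch` would give `s i * u = u * s j`, which is shorter than `u`. -/
theorem SignSystem.not_demL {ι G : Type*} [Group G] {s : ι → G} {P : G → ι → Prop}
    (h : SignSystem s P) {u : G} {i j : ι} (hP : ¬ P u j) :
    ¬ P (demL (Set.range s) (s i) u) j := by
  unfold demL
  split_ifs with hl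
  · intro h1
    have h2 := h.exch (s i * u) i j h1 (by rwa [h.mul_cancel_left])
    rw [h.mul_cancel_left] at h2
    have h3 := h.genLength_mul_lt hP
    have h4 : u * s j = s i * u := by
      nth_rewrite 1 [h2]
      exact h.mul_cancel_right _ _
    rw [h4] at h3
    omega
  · exact hP

theorem mem_minCosetReps_of_demL {X : BCDType} {n i : ℕ} (hn : X.shift < n) (hi : 1 ≤ i)
    (hi' : i ≤ n) {u : weylGroup X n}
    (h : demL (simpleRefls X n) (simpleRefl X n i) u ∈ minCosetReps X n) :
    u ∈ minCosetReps X n := by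
  rw [mem_minCosetReps_iff_simplePos] at h ⊢
  intro j hj
  by_contra hP
  have := (signSystem hn).not_demL (i := ⟨i, hi, hi'⟩) hP
  rw [← simpleRefls_eq] at this
  exact this (h j hj)

/-- If both points were heads, their order in `u` would make `demL` a genuine multiplication, which
then inverts two heads and leaves `W^{P_n}`. If neither were, the same applies to their reversals.
-/
theorem isHead_of_demL_mem {X : BCDType} {n i : ℕ} (hn : X.shift < n) (hi : 1 ≤ i)
    (hi' : i ≤ n) {u : weylGroup X n}
    (h : demL (simpleRefls X n) (simpleRefl X n i) u ∈ minCosetReps X n) :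
    IsHead u.1 (lowerIndex X n i) ↔ ¬ IsHead u.1 i := by
  have hl := lowerIndex_lt hn hi
  have hu := mem_minCosetReps_of_demL hn hi hi' h
  rw [mem_minCosetReps_iff] at hu
  have up : simpleRefl X n i * u ∈ minCosetReps X n → ∀ {a b : ℕ}, a < b →
      simpleVal X n i b < simpleVal X n i a → IsHead u.1 a → IsHead u.1 b → False := by
    rintro hm a b hab hv ⟨x, hx, rfl⟩ ⟨y, hy, rfl⟩
    rw [mem_minCosetReps_iff] at hm
    have hxy : x < y := by
      by_contra hxy
      rcases (not_lt.1 hxy).lt_or_eq with h1 | h1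
      · have := Fin.lt_def.1 (hu y x h1 hx)
        omega
      · rw [h1] at hab
        omega
    have := Fin.lt_def.1 (hm x y hxy hy)
    rw [simpleRefl_mul_val hn hi hi', simpleRefl_mul_val hn hi hi'] at this
    omega
  have l1 := @simpleVal_lower X n i
  have l2 := @simpleVal_upper X n i
  have l3 := simpleVal_rev hn hi hi' (x := lowerIndex X n i) (by omega)
  have l4 := simpleVal_rev hn hi hi' (x := i) (by omega)
  have r1 := isHead_rev hn u (t := 2 * n - 1 - lowerIndex X n i) (t' := lowerIndex X n i) (by omega)
  have r2 := isHead_rev hn u (t := 2 * n - 1 - i) (t' := i) (by omega)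
  by_cases hlen : genLength (simpleRefls X n) u <
      genLength (simpleRefls X n) (simpleRefl X n i * u)
  · rw [demL, if_pos hlen] at h
    constructor
    · intro a b
      exact up h hl (by omega) a b
    · intro b
      by_contra a
      exact up h (a := 2 * n - 1 - i) (b := 2 * n - 1 - lowerIndex X n i) (by omega) (by omega)
        (r2.2 b) (r1.2 a)
  · rw [simpleRefls_eq, (signSystem hn).lt_left_iff u ⟨i, hi, hi'⟩] at hlen
    have hlen : ¬ ((u.1⁻¹ ⟨lowerIndex X n i, by omega⟩ : ℕ) < u.1⁻¹ ⟨i, by omega⟩) := hlen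
    have key : ∀ {a b : ℕ} (ha : a < 2 * n) (hb : b < 2 * n), a < b → IsHead u.1 a →
        IsHead u.1 b → (u.1⁻¹ ⟨a, ha⟩ : ℕ) < u.1⁻¹ ⟨b, hb⟩ := by
      rintro a b ha hb hab ⟨x, hx, rfl⟩ ⟨y, hy, rfl⟩
      have ex : u.1⁻¹ (u.1 x) = x := by simp
      have ey : u.1⁻¹ (u.1 y) = y := by simp
      rw [Fin.eta, Fin.eta, ex, ey]
      by_contra hxy
      rcases (not_lt.1 hxy).lt_or_eq with h1 | h1
      · have := Fin.lt_def.1 (hu y x h1 hx)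
        omega
      · rw [Fin.ext h1] at hab
        omega
    constructor
    · intro a b
      exact hlen (key _ _ hl a b)
    · intro b
      by_contra a
      have := key (by omega) (by omega) (show 2 * n - 1 - i < 2 * n - 1 - lowerIndex X n i by omega)
        (r2.2 b) (r1.2 a)
      have hinv : ∀ (x y : Fin (2 * n)), (y : ℕ) = 2 * n - 1 - x →
          (u.1⁻¹ y : ℕ) = 2 * n - 1 - u.1⁻¹ x := fun x y e => weylGroup_rev hn u⁻¹ x y e
      have k1 := hinv ⟨i, by omega⟩ ⟨2 * n - 1 - i, by omega⟩ rfl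
      have k2 := hinv ⟨lowerIndex X n i, by omega⟩ ⟨2 * n - 1 - lowerIndex X n i, by omega⟩ rfl
      omega

/-! ### The labels of boxes -/

theorem tabEntry_eq {X : BCDType} {n p q : ℕ} (h : p < q ∨ p = q ∧ X.shift = 0)
    : tabEntry X n (p, q) = n - (q - p) - X.shift := by
  cases X
  · simp only [tabEntry, BCDType.shift]
    omega
  · simp only [tabEntry, BCDType.shift]
    omega
  · simp only [tabEntry, BCDType.shift] at h ⊢
    rw [if_neg (by omega)]
    omega

theorem tabEntry_diag {X : BCDType} {n p : ℕ} (h : X.shift = 1) :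
    tabEntry X n (p, p) = if Odd p then n else n - 1 := by
  rw [BCDType.shift_eq_one] at h
  subst h
  simp [tabEntry]

/-- In type D both diagonal labels `n` and `n - 1` have lower point `n - 2`, so the lower point
depends only on the content, whatever the parity of the row. -/
theorem tabEntry_bounds {X : BCDType} {n p q : ℕ} (hpq : p ≤ q) (hd : q - p + X.shift < n) :
    1 ≤ tabEntry X n (p, q) ∧ tabEntry X n (p, q) ≤ n ∧
      lowerIndex X n (tabEntry X n (p, q)) = n - 1 - (q - p) - X.shift := by
  have hs := X.shift_le
  by_cases h : p < q ∨ p = q ∧ X.shift = 0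
  · rw [tabEntry_eq h]
    refine ⟨by omega, by omega, ?_⟩
    unfold lowerIndex
    split_ifs <;> omega
  · have e : p = q := by omega
    subst e
    rw [tabEntry_diag (by omega)]
    unfold lowerIndex
    split_ifs <;> omega

/-- The number of boxes with content `d` in the shifted diagram of `u`. -/
def contentCount (X : BCDType) {n : ℕ} (u : weylGroup X n) (d : ℕ) : ℕ :=
  headCount u.1 (n + d + X.shift)

/-- The upper end of the simple root in box `b` is occupied, if `N` counts the boxes with given
content. -/
def UpperFull (X : BCDType) (N : ℕ → ℕ) (b : ℕ × ℕ) : Prop :=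
  if b.1 < b.2 then N (b.2 - b.1 - 1) = N (b.2 - b.1)
  else if X.shift = 0 then N 0 = N 1 + 1 else N 0 % 2 = b.1 % 2

theorem isHead_lower_iff {X : BCDType} {n p q : ℕ} (hpq : p ≤ q) (hd : q - p + X.shift < n)
    (u : weylGroup X n) : IsHead u.1 (lowerIndex X n (tabEntry X n (p, q))) ↔
      contentCount X u (q - p) = contentCount X u (q - p + 1) := by
  rw [(tabEntry_bounds hpq hd).2.2, isHead_rev (by omega) u (t' := n + (q - p) + X.shift)
    (by omega)]
  unfold contentCount
  rw [show n + (q - p + 1) + X.shift = n + (q - p) + X.shift + 1 by ring]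
  constructor
  · exact headCount_of_not_isHead
  · intro h h'
    rw [headCount_of_isHead h'] at h
    omega

theorem contentCount_succ_le {X : BCDType} {n : ℕ} (u : weylGroup X n) (d : ℕ) :
    contentCount X u (d + 1) ≤ contentCount X u d := by
  unfold contentCount
  rw [show n + (d + 1) + X.shift = n + d + X.shift + 1 by ring]
  by_cases h : IsHead u.1 (n + d + X.shift)
  · rw [headCount_of_isHead h]
    omega
  · rw [headCount_of_not_isHead h]

theorem contentCount_le_succ {X : BCDType} {n : ℕ} (u : weylGroup X n) (d : ℕ) :
    contentCount X u d ≤ contentCount X u (d + 1) + 1 := by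
  unfold contentCount
  rw [show n + (d + 1) + X.shift = n + d + X.shift + 1 by ring]
  by_cases h : IsHead u.1 (n + d + X.shift)
  · rw [headCount_of_isHead h]
  · rw [headCount_of_not_isHead h]
    omega

/-- Off the diagonal the reversal of the label is the threshold for the preceding content. On the
diagonal in type D, the total number of heads `≥ n` is even, so `n` is a head exactly when the
number of diagonal boxes is odd; the label is `n` or its reversal `n - 1` according to the parity of
the row. -/
theorem isHead_upper_iff {X : BCDType} {n p q : ℕ} (hpq : p ≤ q) (hd : q - p + X.shift < n)
    (u : weylGroup X n) : IsHead u.1 (tabEntry X n (p, q)) ↔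
      UpperFull X (contentCount X u) (p, q) := by
  have hs := X.shift_le
  unfold UpperFull
  simp only
  split_ifs with h1 h2
  · rw [tabEntry_eq (.inl h1), isHead_rev (by omega) u (t' := n + (q - p - 1) + X.shift)
      (by omega)]
    unfold contentCount
    rw [show n + (q - p) + X.shift = n + (q - p - 1) + X.shift + 1 by omega]
    constructor
    · exact headCount_of_not_isHead
    · intro h h'
      rw [headCount_of_isHead h'] at h
      omega
  · rw [tabEntry_eq (.inr ⟨by omega, h2⟩)]
    unfold contentCount
    rw [show n - (q - p) - X.shift = n by omega, h2]
    simp only [add_zero]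
    constructor
    · exact headCount_of_isHead
    · intro h
      by_contra h'
      rw [headCount_of_not_isHead h'] at h
      omega
  · have e : p = q := by omega
    subst e
    have hX : X.shift = 1 := by omega
    rw [tabEntry_diag hX]
    have hev := even_headCount (by omega) (BCDType.shift_eq_one.1 hX) u
    unfold contentCount
    rw [hX, add_zero]
    by_cases hh : IsHead u.1 n
    · rw [headCount_of_isHead hh] at hev
      split_ifs with ho
      · simp only [hh, true_iff]
        grind
      · rw [isHead_rev (by omega) u (t' := n) (by omega)]
        simp only [hh, not_true, false_iff]
        grind
    · rw [headCount_of_not_isHead hh] at hev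
      split_ifs with ho
      · simp only [hh, false_iff]
        grind
      · rw [isHead_rev (by omega) u (t' := n) (by omega)]
        simp only [hh, not_false_iff, true_iff]
        grind

/-! ### Shifted diagrams of minimal coset representatives -/

/-- The different truncations of the parts in types B, C and D amount to the one threshold `n +
X.shift`. -/
theorem lt_strictPart_iff {X : BCDType} {n i d : ℕ} (hi : 1 ≤ i) (hi' : i ≤ n)
    (u : Equiv.Perm (Fin (2 * n))) :
    d < strictPart X u i ↔ n + d + X.shift ≤ (u ⟨n - i, by omega⟩ : ℕ) := by
  have e : oneLine u (n + 1 - i) = (u ⟨n - i, by omega⟩ : ℕ) + 1 := by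
    rw [oneLine, dif_pos (by omega)]
    congr 4
    omega
  cases X <;> simp only [strictPart, partOf, e, BCDType.shift] <;> omega

theorem mem_readBoxes {n : ℕ} {μ : ℕ → ℕ} {b : ℕ × ℕ} :
    b ∈ readBoxes n μ ↔ 1 ≤ b.1 ∧ b.1 ≤ n ∧ b.1 ≤ b.2 ∧ b.2 - b.1 < μ b.1 := by
  obtain ⟨i, j⟩ := b
  simp only [readBoxes, List.mem_flatMap, List.mem_reverse, List.mem_range, List.mem_map,
    Prod.mk.injEq]
  constructor
  · rintro ⟨a, ha, b, hb, rfl, rfl⟩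
    exact ⟨by omega, by omega, by omega, by rwa [Nat.add_sub_cancel_left]⟩
  · rintro ⟨h1, h2, h3, h4⟩
    refine ⟨i - 1, by omega, j - i, ?_, by omega, by omega⟩
    rwa [Nat.sub_add_cancel h1]

theorem contentCount_le {X : BCDType} {n : ℕ} (u : weylGroup X n) (d : ℕ) :
    contentCount X u d ≤ n := by
  unfold contentCount headCount
  calc _ ≤ ((Finset.range n).attachFin (n := 2 * n) fun m hm => by
        rw [Finset.mem_range] at hm; omega).card := by
        apply Finset.card_le_card
        intro x hx
        simp only [Finset.mem_filter, Finset.mem_univ, true_and] at hx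
        simpa using hx.1
    _ = n := by simp

theorem contentCount_pos {X : BCDType} {n d : ℕ} {u : weylGroup X n}
    (h : 1 ≤ contentCount X u d) : d + X.shift < n := by
  by_contra hd
  unfold contentCount at h
  rw [headCount_eq_zero _ (by omega)] at h
  omega

/-- The boxes of the list are the boxes of the shifted diagram of the minimal coset
representative `u`. -/
def IsDiagramOf (X : BCDType) {n : ℕ} (M : List (ℕ × ℕ)) (u : weylGroup X n) : Prop :=
  u ∈ minCosetReps X n ∧
    ∀ b, b ∈ M ↔ 1 ≤ b.1 ∧ b.1 ≤ b.2 ∧ b.1 ≤ contentCount X u (b.2 - b.1)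

theorem isDiagramOf_readBoxes {X : BCDType} {n : ℕ} {u : weylGroup X n}
    (hu : u ∈ minCosetReps X n) : IsDiagramOf X (readBoxes n (strictPart X u.1)) u := by
  refine ⟨hu, fun b => ?_⟩
  rw [mem_readBoxes]
  have h : ∀ h1 : 1 ≤ b.1, b.1 ≤ n →
      (b.2 - b.1 < strictPart X u.1 b.1 ↔ b.1 ≤ contentCount X u (b.2 - b.1)) := by
    intro h1 h2
    rw [lt_strictPart_iff h1 h2, headCount_apply hu _ (by simp only; omega)]
    unfold contentCount
    simp only
    omega
  constructor
  · rintro ⟨h1, h2, h3, h4⟩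
    exact ⟨h1, h3, (h h1 h2).1 h4⟩
  · rintro ⟨h1, h3, h4⟩
    have h2 := h4.trans (contentCount_le u _)
    exact ⟨h1, h2, h3, (h h1 h2).2 h4⟩

theorem isDiagramOf_one (X : BCDType) (n : ℕ) : IsDiagramOf X [] (1 : weylGroup X n) := by
  constructor
  · rw [mem_minCosetReps_iff]
    intro x y hxy _
    exact hxy
  · intro b
    have : contentCount X (1 : weylGroup X n) (b.2 - b.1) = 0 := by
      unfold contentCount headCount
      rw [Finset.card_eq_zero, Finset.filter_eq_empty_iff]
      intro x _
      change ¬ ((x : ℕ) < n ∧ _ ≤ (x : ℕ))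
      omega
    rw [this]
    simp only [List.not_mem_nil, false_iff]
    omega

theorem IsDiagramOf.unique {X : BCDType} {n : ℕ} (hn : X.shift < n) {M M' : List (ℕ × ℕ)}
    {u u' : weylGroup X n} (h : IsDiagramOf X M u) (h' : IsDiagramOf X M' u')
    (hM : ∀ b, b ∈ M ↔ b ∈ M') : u = u' := by
  have hc : ∀ d, contentCount X u d = contentCount X u' d := by
    intro d
    apply eq_of_forall_le_iff
    intro k
    rcases Nat.eq_zero_or_pos k with rfl | hk
    · simp
    · have h1 := h.2 (k, k + d)
      have h2 := h'.2 (k, k + d)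
      rw [hM, h2] at h1
      simp only [Nat.add_sub_cancel_left] at h1
      have : k ≤ k + d := by omega
      tauto
  refine minCosetReps_ext hn h.1 h'.1 fun t ht => ?_
  have := hc (t - n - X.shift)
  unfold contentCount at this
  rwa [show n + (t - n - X.shift) + X.shift = t by omega] at this

/-- The simple reflection in the box `b`. -/
def boxRefl (X : BCDType) (n : ℕ) (b : ℕ × ℕ) : weylGroup X n := simpleRefl X n (tabEntry X n b)

/-- The box `b` can be added in its own place. -/
theorem IsDiagramOf.cons {X : BCDType} {n : ℕ} {M : List (ℕ × ℕ)} {u : weylGroup X n}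
    {b : ℕ × ℕ} (h : IsDiagramOf X M u) (hb1 : 1 ≤ b.1) (hb2 : b.1 ≤ b.2)
    (hd : b.2 - b.1 + X.shift < n)
    (hN : contentCount X u (b.2 - b.1) = contentCount X u (b.2 - b.1 + 1))
    (hU : ¬ UpperFull X (contentCount X u) b) :
    boxRefl X n b * u ∈ minCosetReps X n ∧
    demL (simpleRefls X n) (boxRefl X n b) u = boxRefl X n b * u ∧
    genLength (simpleRefls X n) u < genLength (simpleRefls X n) (boxRefl X n b * u) ∧
    (contentCount X u (b.2 - b.1) + 1 = b.1 → IsDiagramOf X (b :: M) (boxRefl X n b * u)) := by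
  obtain ⟨p, q⟩ := b
  simp only at hb1 hb2 hd hN ⊢
  have hn : X.shift < n := by omega
  have hlow := (isHead_lower_iff hb2 hd u).2 hN
  have hup := mt (isHead_upper_iff hb2 hd u).1 hU
  obtain ⟨b1, b2, b3⟩ := tabEntry_bounds hb2 hd
  have hmem := simpleRefl_mul_mem hn b1 b2 h.1 hlow hup
  have hlen := lt_genLength_simpleRefl_mul hn b1 b2 hlow hup
  refine ⟨hmem, by rw [boxRefl, demL, if_pos hlen], hlen, fun hp => ⟨hmem, ?_⟩⟩
  have hc : ∀ e, contentCount X (boxRefl X n (p, q) * u) e =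
      contentCount X u e + if e = q - p then 1 else 0 := by
    intro e
    unfold contentCount boxRefl
    rw [headCount_simpleRefl_mul hn b1 b2 hlow hup (by omega), b3]
    congr 2
    apply propext
    omega
  rintro ⟨i, j⟩
  rw [List.mem_cons, h.2, hc, Prod.mk.injEq]
  simp only
  split_ifs with he
  · rw [he]
    omega
  · constructor
    · rintro (⟨rfl, rfl⟩ | h)
      · exact absurd rfl he
      · exact h
    · exact .inr

/-- Under the assumption that the product stays in `W^{P_n}`, a reflection either adds a box of its
content, not necessarily in the place `b`, or is absorbed. -/
theorem demL_cases {X : BCDType} {n : ℕ} {u : weylGroup X n} {b : ℕ × ℕ}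
    (hb2 : b.1 ≤ b.2) (hd : b.2 - b.1 + X.shift < n)
    (h : demL (simpleRefls X n) (boxRefl X n b) u ∈ minCosetReps X n) :
    u ∈ minCosetReps X n ∧
    (contentCount X u (b.2 - b.1) = contentCount X u (b.2 - b.1 + 1) ∧
      ¬ UpperFull X (contentCount X u) b ∨
    contentCount X u (b.2 - b.1) = contentCount X u (b.2 - b.1 + 1) + 1 ∧
      UpperFull X (contentCount X u) b ∧ demL (simpleRefls X n) (boxRefl X n b) u = u) := by
  obtain ⟨p, q⟩ := b
  simp only at hb2 hd ⊢
  have hn : X.shift < n := by omega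
  obtain ⟨b1, b2, b3⟩ := tabEntry_bounds hb2 hd
  have hu := mem_minCosetReps_of_demL hn b1 b2 h
  have hh := isHead_of_demL_mem hn b1 b2 h
  refine ⟨hu, ?_⟩
  by_cases hlow : IsHead u.1 (lowerIndex X n (tabEntry X n (p, q)))
  · left
    rw [← isHead_lower_iff hb2 hd, ← isHead_upper_iff hb2 hd]
    exact ⟨hlow, hh.1 hlow⟩
  · right
    have hup := not_not.1 (mt hh.2 hlow)
    refine ⟨?_, (isHead_upper_iff hb2 hd u).1 hup, demL_of_not_isHead hn b1 b2 hlow hup⟩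
    rw [isHead_lower_iff hb2 hd] at hlow
    have h1 := contentCount_succ_le u (q - p)
    have h2 := contentCount_le_succ u (q - p)
    omega

/-! ### The reading order -/

/-- The order of boxes from top to bottom and from left to right. -/
def BoxLT (a b : ℕ × ℕ) : Prop := a.1 < b.1 ∨ a.1 = b.1 ∧ a.2 < b.2

theorem readBoxes_pairwise (n : ℕ) (μ : ℕ → ℕ) :
    (readBoxes n μ).Pairwise fun a b => BoxLT b a := by
  unfold readBoxes
  rw [List.pairwise_flatMap]
  constructor
  · intro a _
    rw [List.pairwise_map, List.pairwise_reverse]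
    refine List.pairwise_lt_range.imp ?_
    intro x y hxy
    exact .inr ⟨rfl, by simp only; omega⟩
  · rw [List.pairwise_reverse]
    refine List.pairwise_lt_range.imp ?_
    intro x y hxy a ha b hb
    simp only [List.mem_map] at ha hb
    obtain ⟨_, _, rfl⟩ := ha
    obtain ⟨_, _, rfl⟩ := hb
    left
    simp only
    omega

theorem readBoxes_nodup (n : ℕ) (μ : ℕ → ℕ) : (readBoxes n μ).Nodup := by
  refine (readBoxes_pairwise n μ).imp ?_
  rintro a b h rfl
  unfold BoxLT at h
  omega

/-- In a list in reading order, the boxes after `b` are the boxes before `b` in the order of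
boxes. -/
theorem mem_tail_iff {L M : List (ℕ × ℕ)} {b : ℕ × ℕ} (hL : L.Pairwise fun a b => BoxLT b a)
    (hs : b :: M <:+ L) (a : ℕ × ℕ) : a ∈ M ↔ a ∈ L ∧ BoxLT a b := by
  obtain ⟨K, rfl⟩ := hs
  rw [List.pairwise_append, List.pairwise_cons] at hL
  constructor
  · intro ha
    exact ⟨by simp [ha], hL.2.1.1 a ha⟩
  · rintro ⟨ha, hab⟩
    rcases List.mem_append.1 ha with h | h
    · have := hL.2.2 a h b (by simp)
      unfold BoxLT at *
      omega
    · rcases List.mem_cons.1 h with rfl | h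
      · unfold BoxLT at hab
        omega
      · exact h

/-- The Demazure product of the labels of a list of boxes. -/
noncomputable def demWord (X : BCDType) (n : ℕ) (L : List (ℕ × ℕ)) : weylGroup X n :=
  L.foldr (fun b u => demL (simpleRefls X n) (boxRefl X n b) u) 1

theorem demWord_cons (X : BCDType) (n : ℕ) (b : ℕ × ℕ) (L : List (ℕ × ℕ)) :
    demWord X n (b :: L) = demL (simpleRefls X n) (boxRefl X n b) (demWord X n L) := rfl

/-- The conditions under which a box can be added in its own place hold if its neighbours are
there. -/
theorem IsDiagramOf.addable {X : BCDType} {n : ℕ} {M : List (ℕ × ℕ)} {u : weylGroup X n}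
    {b : ℕ × ℕ} (h : IsDiagramOf X M u) (hb1 : 1 ≤ b.1) (hb2 : b.1 ≤ b.2) (hbM : b ∉ M)
    (hup : 1 < b.1 → (b.1 - 1, b.2) ∈ M) (hleft : b.1 < b.2 → (b.1, b.2 - 1) ∈ M) :
    contentCount X u (b.2 - b.1) = contentCount X u (b.2 - b.1 + 1) ∧
      ¬ UpperFull X (contentCount X u) b ∧ contentCount X u (b.2 - b.1) + 1 = b.1 := by
  obtain ⟨p, q⟩ := b
  simp only [h.2] at *
  have h1 := contentCount_succ_le u (q - p)
  have hN : p ≤ contentCount X u (q - p + 1) + 1 := by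
    rcases hb1.lt_or_eq with hp | hp
    · have := (hup hp).2.2
      rw [show q - (p - 1) = q - p + 1 by omega] at this
      omega
    · omega
  have h3 : contentCount X u (q - p) < p := by
    by_contra h4
    exact hbM ⟨hb1, hb2, by omega⟩
  refine ⟨by omega, ?_, by omega⟩
  unfold UpperFull
  simp only
  split_ifs with h5 h6
  · have := (hleft h5).2.2
    rw [show q - 1 - p = q - p - 1 by omega] at this
    omega
  · rw [show q - p = 0 by omega, zero_add] at *
    omega
  · rw [show q - p = 0 by omega] at *
    omega

/-- The boxes of a suffix are those up to its first box in the order `BoxLT`. The upper and left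
neighbours of that box come earlier in this order, so `addable` applies, and each box raises the
length by exactly one. -/
theorem isDiagramOf_suffix {X : BCDType} {n : ℕ} {L : List (ℕ × ℕ)} {v : weylGroup X n}
    (hL : L.Pairwise fun a b => BoxLT b a) (hv : IsDiagramOf X L v) {M : List (ℕ × ℕ)}
    (hM : M <:+ L) : IsDiagramOf X M (demWord X n M) ∧
      demWord X n M = (M.map (boxRefl X n)).prod ∧
      genLength (simpleRefls X n) (demWord X n M) = M.length := by
  induction M with
  | nil => exact ⟨isDiagramOf_one X n, rfl, genLength_one _⟩
  | cons b M ih =>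
    obtain ⟨ih1, ih2, ih3⟩ := ih ((List.suffix_cons b M).trans hM)
    have hmem := mem_tail_iff hL hM
    obtain ⟨hb1, hb2, hb3⟩ := (hv.2 b).1 (hM.subset (by simp))
    have hd := contentCount_pos (u := v) (d := b.2 - b.1) (by omega)
    have hn : X.shift < n := by omega
    have hadd := ih1.addable hb1 hb2 (by
        rw [hmem]
        unfold BoxLT
        omega) (by
        intro h
        rw [hmem, hv.2]
        have := contentCount_le_succ v (b.2 - b.1)
        refine ⟨⟨by simp only; omega, by simp only; omega, ?_⟩, .inl (by simp only; omega)⟩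
        simp only
        rw [show b.2 - (b.1 - 1) = b.2 - b.1 + 1 by omega]
        omega) (by
        intro h
        rw [hmem, hv.2]
        have := contentCount_succ_le v (b.2 - b.1 - 1)
        rw [show b.2 - b.1 - 1 + 1 = b.2 - b.1 by omega] at this
        refine ⟨⟨by simp only; omega, by simp only; omega, ?_⟩,
          .inr ⟨rfl, by simp only; omega⟩⟩
        simp only
        rw [show b.2 - 1 - b.1 = b.2 - b.1 - 1 by omega]
        omega)
    obtain ⟨-, c2, c3, c4⟩ := ih1.cons hb1 hb2 hd hadd.1 hadd.2.1
    rw [demWord_cons, c2]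
    refine ⟨c4 hadd.2.2, by rw [ih2, List.map_cons, List.prod_cons], ?_⟩
    have hle : genLength (simpleRefls X n) (boxRefl X n b * demWord X n M) ≤
        genLength (simpleRefls X n) (demWord X n M) + 1 := by
      obtain ⟨b1, b2, -⟩ := tabEntry_bounds hb2 hd
      rw [simpleRefls_eq]
      exact (signSystem hn).genLength_mul_le ⟨_, b1, b2⟩ _
    rw [List.length_cons]
    omega

theorem demWord_of_isDiagramOf {X : BCDType} {n : ℕ} (hn : X.shift < n) {L : List (ℕ × ℕ)}
    {v : weylGroup X n} (hL : L.Pairwise fun a b => BoxLT b a) (hv : IsDiagramOf X L v) :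
    demWord X n L = v :=
  (isDiagramOf_suffix hL hv L.suffix_refl).1.unique hn hv fun _ => Iff.rfl

/-! ### Excitations preserve the 0-Hecke product -/

/-- The factor at `b` commutes past the selected factors of `Y` to reach `a`, where it either takes
the place of the equal factor or is absorbed by idempotence. -/
theorem prod_filter_insert {α M : Type*} [DecidableEq α] [Monoid M] (f : α → M) {K Y Z : List α}
    {S : Finset α} {a b : α} (hnd : (K ++ b :: (Y ++ a :: Z)).Nodup) (ha : a ∈ S) (hb : b ∉ S)
    (hab : f a = f b) (hsq : f b * f b = f b) (hY : ∀ y ∈ Y, y ∈ S → Commute (f b) (f y))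
    {S' : Finset α} (hS' : S' = insert b (S.erase a) ∨ S' = insert b S) :
    (((K ++ b :: (Y ++ a :: Z)).filter (· ∈ S')).map f).prod =
      (((K ++ b :: (Y ++ a :: Z)).filter (· ∈ S)).map f).prod := by
  have hmem : ∀ x, x ≠ a → x ≠ b → (x ∈ S' ↔ x ∈ S) := by
    intro x h1 h2
    rcases hS' with rfl | rfl <;> simp [h1, h2]
  have hne : ∀ x, x ∈ K ∨ x ∈ Y ∨ x ∈ Z → x ≠ a ∧ x ≠ b := by
    intro x hx
    simp only [List.nodup_append, List.nodup_cons, List.mem_cons, List.mem_append] at hnd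
    constructor
    · rintro rfl
      grind
    · rintro rfl
      grind
  have hf : ∀ A : List α, (∀ x ∈ A, x ≠ a ∧ x ≠ b) → A.filter (· ∈ S') = A.filter (· ∈ S) := by
    intro A hA
    refine List.filter_congr fun x hx => ?_
    rw [decide_eq_decide]
    exact hmem x (hA x hx).1 (hA x hx).2
  have hab' : a ≠ b := by
    rintro rfl
    exact hb ha
  have hbS' : b ∈ S' := by rcases hS' with rfl | rfl <;> simp
  have hc : Commute (f b) ((Y.filter (· ∈ S)).map f).prod := by
    refine Commute.list_prod_right _ _ fun x hx => ?_
    simp only [List.mem_map, List.mem_filter, decide_eq_true_eq] at hx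
    obtain ⟨y, ⟨h1, h2⟩, rfl⟩ := hx
    exact hY y h1 h2
  simp only [List.filter_append, List.filter_cons, decide_eq_true_eq, ha, hb, hbS', if_true,
    if_false, List.map_append, List.prod_append, List.map_cons, List.prod_cons,
    hf K (fun x hx => hne x (.inl hx)), hf Y (fun x hx => hne x (.inr (.inl hx))),
    hf Z (fun x hx => hne x (.inr (.inr hx)))]
  congr 1
  rw [hab]
  by_cases h : a ∈ S'
  · rw [if_pos h, List.map_cons, List.prod_cons, hab, ← mul_assoc, hc.eq, mul_assoc,
      ← mul_assoc (f b) (f b), hsq]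
  · rw [if_neg h, ← mul_assoc, hc.eq, mul_assoc]

/-- The common form of all six excitations. The places required to be empty are exactly those
between `a` and `b` in the reading order whose content is within one of that of `b`, so the selected
boxes in between carry commuting reflections. -/
theorem Excitation.spec {X : BCDType} {n : ℕ} {D S S' : Finset (ℕ × ℕ)} (h : Excitation X D S S')
    (hD : ∀ b ∈ D, b.1 ≤ b.2) : ∃ a b, a ∈ S ∧ b ∈ D ∧ b ∉ S ∧ BoxLT a b ∧
      tabEntry X n a = tabEntry X n b ∧ b.2 - b.1 = a.2 - a.1 ∧
      (∀ y ∈ D, y ∈ S → BoxLT a y → BoxLT y b →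
        b.2 - b.1 + 2 ≤ y.2 - y.1 ∨ y.2 - y.1 + 2 ≤ b.2 - b.1) ∧
      (S' = insert b (S.erase a) ∨ S' = insert b S) := by
  have off : ∀ i j, i < j → tabEntry X n (i, j) = tabEntry X n (i + 1, j + 1) := by
    intro i j hij
    cases X <;> simp only [tabEntry]
    · omega
    · omega
    · rw [if_neg (by omega), if_neg (by omega)]
      omega
  have ne : ∀ {y x : ℕ × ℕ}, y ∈ S → x ∈ D \ S → ¬ (y.1 = x.1 ∧ y.2 = x.2) := by
    rintro y x hy hx ⟨h1, h2⟩
    rw [Prod.ext h1 h2] at hy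
    exact (Finset.mem_sdiff.1 hx).2 hy
  have offDiag : ∀ i j, i < j → (i + 1, j) ∈ D \ S → (i, j + 1) ∈ D \ S →
      ∀ y ∈ D, y ∈ S → BoxLT (i, j) y → BoxLT y (i + 1, j + 1) →
        j + 1 - (i + 1) + 2 ≤ y.2 - y.1 ∨ y.2 - y.1 + 2 ≤ j + 1 - (i + 1) := by
    intro i j hij h1 h2 y hyD hyS l1 l2
    have n1 := ne hyS h1
    have n2 := ne hyS h2
    have := hD y hyD
    unfold BoxLT at l1 l2
    simp only at *
    omega
  have diagBC : ∀ i, (i, i + 1) ∈ D \ S →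
      ∀ y ∈ D, y ∈ S → BoxLT (i, i) y → BoxLT y (i + 1, i + 1) →
        i + 1 - (i + 1) + 2 ≤ y.2 - y.1 ∨ y.2 - y.1 + 2 ≤ i + 1 - (i + 1) := by
    intro i h1 y hyD hyS l1 l2
    have n1 := ne hyS h1
    have := hD y hyD
    unfold BoxLT at l1 l2
    simp only at *
    omega
  have diagD : ∀ i, (i, i + 1) ∈ D \ S → (i + 1, i + 1) ∈ D \ S → (i + 1, i + 2) ∈ D \ S →
      ∀ y ∈ D, y ∈ S → BoxLT (i, i) y → BoxLT y (i + 2, i + 2) →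
        i + 2 - (i + 2) + 2 ≤ y.2 - y.1 ∨ y.2 - y.1 + 2 ≤ i + 2 - (i + 2) := by
    intro i h1 h2 h3 y hyD hyS l1 l2
    have n1 := ne hyS h1
    have n2 := ne hyS h2
    have n3 := ne hyS h3
    have := hD y hyD
    unfold BoxLT at l1 l2
    simp only at *
    omega
  have entryBC : ∀ i, X = .B ∨ X = .C → tabEntry X n (i, i) = tabEntry X n (i + 1, i + 1) := by
    rintro i (rfl | rfl) <;> simp [tabEntry]
  have entryD : ∀ i, X = .D → tabEntry X n (i, i) = tabEntry X n (i + 2, i + 2) := by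
    rintro i rfl
    simp [tabEntry, Nat.odd_add]
  have lt1 : ∀ i j k l, i < k → BoxLT (i, j) (k, l) := fun i j k l h => .inl h
  cases h with
  | offDiag1 i j hij hS h1 h2 h3 =>
    rw [Finset.mem_sdiff] at h3
    exact ⟨(i, j), (i + 1, j + 1), hS, h3.1, h3.2, lt1 _ _ _ _ (by omega), off i j hij,
      by simp only; omega, offDiag i j hij h1 h2, .inl rfl⟩
  | offDiag2 i j hij hS h1 h2 h3 =>
    rw [Finset.mem_sdiff] at h3
    exact ⟨(i, j), (i + 1, j + 1), hS, h3.1, h3.2, lt1 _ _ _ _ (by omega), off i j hij,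
      by simp only; omega, offDiag i j hij h1 h2, .inr rfl⟩
  | diagBC1 i hX hS h1 h2 =>
    rw [Finset.mem_sdiff] at h2
    exact ⟨(i, i), (i + 1, i + 1), hS, h2.1, h2.2, lt1 _ _ _ _ (by omega), entryBC i hX,
      by simp only; omega, diagBC i h1, .inl rfl⟩
  | diagBC2 i hX hS h1 h2 =>
    rw [Finset.mem_sdiff] at h2
    exact ⟨(i, i), (i + 1, i + 1), hS, h2.1, h2.2, lt1 _ _ _ _ (by omega), entryBC i hX,
      by simp only; omega, diagBC i h1, .inr rfl⟩
  | diagD1 i hX hS h1 h2 h3 h4 =>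
    rw [Finset.mem_sdiff] at h4
    exact ⟨(i, i), (i + 2, i + 2), hS, h4.1, h4.2, lt1 _ _ _ _ (by omega), entryD i hX,
      by simp only; omega, diagD i h1 h2 h3, .inl rfl⟩
  | diagD2 i hX hS h1 h2 h3 h4 =>
    rw [Finset.mem_sdiff] at h4
    exact ⟨(i, i), (i + 2, i + 2), hS, h4.1, h4.2, lt1 _ _ _ _ (by omega), entryD i hX,
      by simp only; omega, diagD i h1 h2 h3, .inr rfl⟩

/-! ### Commuting reflections and products over sets of boxes -/

theorem simpleVal_cases (X : BCDType) (n i x : ℕ) {l : ℕ} (hl : l = lowerIndex X n i) :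
    (x = l ∨ x = i ∨ x = 2 * n - 1 - l ∨ x = 2 * n - 1 - i) ∧
      (simpleVal X n i x = l ∨ simpleVal X n i x = i ∨ simpleVal X n i x = 2 * n - 1 - l ∨
        simpleVal X n i x = 2 * n - 1 - i) ∨
    (x ≠ l ∧ x ≠ i ∧ x ≠ 2 * n - 1 - l ∧ x ≠ 2 * n - 1 - i) ∧ simpleVal X n i x = x := by
  unfold simpleVal
  rw [← hl]
  split_ifs <;> simp_all

/-- The inequality makes the sets of points moved by `s_i` and `s_j` disjoint. -/
theorem simpleRefl_commute {X : BCDType} {n i j : ℕ} (hn : X.shift < n) (hi : 1 ≤ i)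
    (hij : i < lowerIndex X n j) (hj : 1 ≤ j) (hj' : j ≤ n) :
    simpleRefl X n i * simpleRefl X n j = simpleRefl X n j * simpleRefl X n i := by
  obtain ⟨l, hlj⟩ : ∃ l, l = lowerIndex X n j := ⟨_, rfl⟩
  have hl := lowerIndex_lt hn hj
  rw [← hlj] at hij hl
  have hi' : i ≤ n := by omega
  have hli : i - 1 = lowerIndex X n i := (if_neg (by omega)).symm
  ext x
  rw [simpleRefl_mul_val hn hi hi', simpleRefl_mul_val hn hj hj', simpleRefl_val hi hi',
    simpleRefl_val hj hj', simplePerm_val hn hi hi', simplePerm_val hn hj hj']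
  rcases simpleVal_cases X n i x hli with ⟨h1, h2⟩ | ⟨h1, h2⟩
  · rw [simpleVal_of_ne (i := j) (x := (x : ℕ)),
      simpleVal_of_ne (i := j) (x := simpleVal X n i x)] <;> omega
  · rw [h2]
    rcases simpleVal_cases X n j x hlj with ⟨h3, h4⟩ | ⟨h3, h4⟩
    · rw [simpleVal_of_ne (i := i)] <;> omega
    · rw [h4, h2]

theorem heckeH_boxRefl_commute {X : BCDType} {n : ℕ} (R : Type*) [CommRing R] {a b : ℕ × ℕ}
    (ha : a.1 ≤ a.2) (hb : b.1 ≤ b.2) (ha' : a.2 - a.1 + X.shift < n)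
    (hb' : b.2 - b.1 + X.shift < n) (hab : a.2 - a.1 + 2 ≤ b.2 - b.1) :
    Commute (heckeH R (simpleRefls X n) (boxRefl X n a))
      (heckeH R (simpleRefls X n) (boxRefl X n b)) := by
  obtain ⟨p, q⟩ := a
  obtain ⟨p', q'⟩ := b
  simp only at *
  have hn : X.shift < n := by omega
  obtain ⟨a1, a2, a3⟩ := tabEntry_bounds ha ha'
  obtain ⟨b1, b2, -⟩ := tabEntry_bounds hb hb'
  have hlt : tabEntry X n (p', q') < lowerIndex X n (tabEntry X n (p, q)) := by
    rw [a3, tabEntry_eq (.inl (by omega))]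
    omega
  rw [simpleRefls_eq]
  exact (signSystem hn).heckeH_commute R (i := ⟨_, a1, a2⟩) (j := ⟨_, b1, b2⟩)
    (simpleRefl_commute hn b1 hlt a1 a2).symm

/-- The product of the generators of the 0-Hecke algebra in a list of boxes. -/
noncomputable def heckeWord (R : Type*) [CommRing R] (X : BCDType) (n : ℕ) (L : List (ℕ × ℕ)) :
    ZeroHecke R (simpleRefls X n) :=
  (L.map fun b => heckeH R (simpleRefls X n) (boxRefl X n b)).prod

theorem heckeWord_eq {X : BCDType} {n : ℕ} (R : Type*) [CommRing R] (hn : X.shift < n)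
    (L : List (ℕ × ℕ)) (hL : ∀ b ∈ L, b.1 ≤ b.2 ∧ b.2 - b.1 + X.shift < n) :
    heckeWord R X n L = heckeH R (simpleRefls X n) (demWord X n L) := by
  induction L with
  | nil =>
    exact (heckeH_one R _).symm
  | cons b L ih =>
    obtain ⟨h1, h2⟩ := hL b (by simp)
    obtain ⟨b1, b2, -⟩ := tabEntry_bounds h1 h2
    have h3 := (signSystem hn).heckeH_mul R ⟨_, b1, b2⟩ (demWord X n L)
    rw [← simpleRefls_eq] at h3
    rw [demWord_cons, boxRefl, ← h3, ← ih fun b hb => hL b (by simp [hb])]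
    rfl

theorem IsDiagramOf.bounds {X : BCDType} {n : ℕ} {L : List (ℕ × ℕ)} {v : weylGroup X n}
    (hv : IsDiagramOf X L v) {b : ℕ × ℕ} (hb : b ∈ L) :
    b.1 ≤ b.2 ∧ b.2 - b.1 + X.shift < n := by
  obtain ⟨h1, h2, h3⟩ := (hv.2 b).1 hb
  exact ⟨h2, contentCount_pos (u := v) (by omega)⟩

theorem heckeWord_excitation {X : BCDType} {n : ℕ} (R : Type*) [CommRing R]
    {L : List (ℕ × ℕ)} {v : weylGroup X n} (hL : L.Pairwise fun a b => BoxLT b a)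
    (hv : IsDiagramOf X L v) {S S' : Finset (ℕ × ℕ)} (hS : S ⊆ L.toFinset)
    (h : Excitation X L.toFinset S S') :
    S' ⊆ L.toFinset ∧
      heckeWord R X n (L.filter (· ∈ S')) = heckeWord R X n (L.filter (· ∈ S)) := by
  obtain ⟨a, b, haS, hbD, hbS, hab, htab, hcont, hcomm, hS'⟩ := h.spec (n := n)
    (fun b hb => (hv.bounds (List.mem_toFinset.1 hb)).1)
  refine ⟨?_, ?_⟩
  · intro x hx
    rcases hS' with rfl | rfl
    · rcases Finset.mem_insert.1 hx with rfl | hx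
      · exact hbD
      · exact hS (Finset.mem_of_mem_erase hx)
    · rcases Finset.mem_insert.1 hx with rfl | hx
      · exact hbD
      · exact hS hx
  have haL := List.mem_toFinset.1 (hS haS)
  have hbL := List.mem_toFinset.1 hbD
  obtain ⟨K, T, rfl⟩ := List.append_of_mem hbL
  have haT := (mem_tail_iff hL (List.suffix_append K _) a).2 ⟨haL, hab⟩
  obtain ⟨Y, Z, rfl⟩ := List.append_of_mem haT
  have hnd : (K ++ b :: (Y ++ a :: Z)).Nodup := by
    refine hL.imp ?_
    rintro x y hxy rfl
    unfold BoxLT at hxy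
    omega
  have hb := hv.bounds hbL
  obtain ⟨b1, b2, -⟩ := tabEntry_bounds hb.1 hb.2
  have hsq := heckeH_sq R (S := simpleRefls X n) (s := boxRefl X n b) ⟨_, ⟨b1, b2⟩, rfl⟩
  refine prod_filter_insert _ hnd haS hbS ?_ hsq ?_ hS'
  · simp only [boxRefl, htab]
  · intro y hy hyS
    have hyL : y ∈ K ++ b :: (Y ++ a :: Z) := by simp [hy]
    have hyb := ((mem_tail_iff hL (List.suffix_append K _) y).1 (by simp [hy])).2
    have hay : BoxLT a y := by
      have h1 := (List.pairwise_append.1 hL).2.1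
      have h2 := (List.pairwise_cons.1 h1).2
      exact (List.pairwise_append.1 h2).2.2 y hy a (by simp)
    have hyB := hv.bounds hyL
    rcases hcomm y (List.mem_toFinset.2 hyL) hyS hay hyb with h | h
    · exact heckeH_boxRefl_commute R hb.1 hyB.1 hb.2 hyB.2 h
    · exact (heckeH_boxRefl_commute R hyB.1 hb.1 hyB.2 hb.2 h).symm

/-! ### Undoing excitations -/

/-- Induction over suffixes, with `u` the product over the boxes of `C` in `M`. If `b` does not
extend the diagram of `u` in its own place, then `demL_cases` bounds the head counts of `u` so that
the places needed for an excitation from `a` to `b` are outside `C`; the diagram of `v` contains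
them because it contains `b`. -/
theorem isDiagramOf_or_excitation {X : BCDType} {n : ℕ} {L : List (ℕ × ℕ)} {v : weylGroup X n}
    (hL : L.Pairwise fun a b => BoxLT b a) (hv : IsDiagramOf X L v) {C : Finset (ℕ × ℕ)}
    (hC : C ⊆ L.toFinset) {M : List (ℕ × ℕ)} (hM : M <:+ L)
    (hmin : demWord X n (M.filter (· ∈ C)) ∈ minCosetReps X n) :
    IsDiagramOf X (M.filter (· ∈ C)) (demWord X n (M.filter (· ∈ C))) ∨
      ∃ a b, b ∈ C ∧ a ∈ L.toFinset ∧ a.1 < b.1 ∧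
        Excitation X L.toFinset (insert a (C.erase b)) C := by
  induction M with
  | nil => exact .inl (isDiagramOf_one X n)
  | cons b M ih =>
    have hM' := (List.suffix_cons b M).trans hM
    by_cases hbC : b ∈ C
    swap
    · rw [List.filter_cons, if_neg (by simpa using hbC)] at hmin ⊢
      exact ih hM' hmin
    rw [List.filter_cons, if_pos (by simpa using hbC)] at hmin ⊢
    rw [demWord_cons] at hmin ⊢
    obtain ⟨hb1, hb2, hb3⟩ := (hv.2 b).1 (hM.subset (by simp))
    have hd := contentCount_pos (u := v) (d := b.2 - b.1) (by omega)
    obtain ⟨hu, hcases⟩ := demL_cases hb2 hd hmin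
    rcases ih hM' hu with ih | ih
    swap
    · exact .inr ih
    have hmem : ∀ x, BoxLT x b → (x ∈ C ↔ 1 ≤ x.1 ∧ x.1 ≤ x.2 ∧
        x.1 ≤ contentCount X (demWord X n (M.filter (· ∈ C))) (x.2 - x.1)) := by
      intro x hx
      rw [← ih.2, List.mem_filter, mem_tail_iff hL hM]
      simp only [decide_eq_true_eq]
      exact ⟨fun h => ⟨⟨List.mem_toFinset.1 (hC h), hx⟩, h⟩, fun h => h.2⟩
    have hbM : ¬ (1 ≤ b.1 ∧ b.1 ≤ b.2 ∧
        b.1 ≤ contentCount X (demWord X n (M.filter (· ∈ C))) (b.2 - b.1)) := by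
      rw [← ih.2, List.mem_filter, mem_tail_iff hL hM]
      unfold BoxLT
      omega
    by_cases hstraight : contentCount X (demWord X n (M.filter (· ∈ C))) (b.2 - b.1) =
        contentCount X (demWord X n (M.filter (· ∈ C))) (b.2 - b.1 + 1) ∧
        ¬ UpperFull X (contentCount X (demWord X n (M.filter (· ∈ C)))) b ∧
        contentCount X (demWord X n (M.filter (· ∈ C))) (b.2 - b.1) + 1 = b.1
    · left
      obtain ⟨-, c2, -, c4⟩ := ih.cons hb1 hb2 hd hstraight.1 hstraight.2.1
      rw [c2]
      exact c4 hstraight.2.2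
    right
    generalize demWord X n (M.filter (· ∈ C)) = u at *
    obtain ⟨p, q⟩ := b
    simp only at *
    have hins : ∀ {a : ℕ × ℕ}, a ≠ (p, q) → a ∈ C →
        insert (p, q) (insert a (C.erase (p, q))) = C := by
      intro a h1 h2
      rw [Finset.insert_eq_of_mem (Finset.mem_erase.2 ⟨h1, h2⟩), Finset.insert_erase hbC]
    have hins' : ∀ {a : ℕ × ℕ}, a ≠ (p, q) → a ∉ C →
        insert (p, q) ((insert a (C.erase (p, q))).erase a) = C := by
      intro a h1 h2
      rw [Finset.erase_insert (fun h => h2 (Finset.mem_of_mem_erase h)), Finset.insert_erase hbC]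
    have hout : ∀ {a x : ℕ × ℕ}, x ≠ a → x ∉ C → 1 ≤ x.1 → x.1 ≤ x.2 →
        x.1 ≤ contentCount X v (x.2 - x.1) → x ∈ L.toFinset \ insert a (C.erase (p, q)) := by
      intro a x h1 h2 h3 h4 h5
      rw [Finset.mem_sdiff, List.mem_toFinset, hv.2, Finset.mem_insert, Finset.mem_erase]
      exact ⟨⟨h3, h4, h5⟩, fun h => h.elim h1 fun h => h2 h.2⟩
    have houtb : ∀ {a : ℕ × ℕ}, (p, q) ≠ a →
        (p, q) ∈ L.toFinset \ insert a (C.erase (p, q)) := by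
      intro a h1
      rw [Finset.mem_sdiff, Finset.mem_insert, Finset.mem_erase]
      exact ⟨hC hbC, fun h => h.elim h1 fun h => h.1 rfl⟩
    have v1 := contentCount_le_succ v (q - p)
    have v2 := contentCount_succ_le v (q - p)
    have u1 := contentCount_le_succ u (q - p)
    have u2 := contentCount_succ_le u (q - p)
    by_cases hdiag : p = q ∧ X.shift = 1
    · obtain ⟨rfl, hX⟩ := hdiag
      have hX' := BCDType.shift_eq_one.1 hX
      unfold UpperFull at hcases hstraight
      simp only [lt_irrefl, if_false, hX, one_ne_zero, Nat.sub_self, zero_add] at *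
      -- The count of content `0` is below `p`. Either it has the parity of `p` and exceeds the
      -- count of content `1` by one, or it has the other parity, equals that count and is not `p -
      -- 1`.
      have w : contentCount X u 1 + 3 ≤ p ∧ contentCount X u 0 + 2 ≤ p := by omega
      obtain ⟨w1, w2⟩ := w
      obtain ⟨i, rfl⟩ : ∃ i, p = i + 2 := ⟨p - 2, by omega⟩
      have o1 : (i, i + 1) ∉ C := by
        rw [hmem _ (.inl (by simp))]
        simp only [Nat.add_sub_cancel_left]
        omega
      have o2 : (i + 1, i + 1) ∉ C := by
        rw [hmem _ (.inl (by simp))]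
        simp only [Nat.sub_self]
        omega
      have o3 : (i + 1, i + 2) ∉ C := by
        rw [hmem _ (.inl (by simp))]
        simp only [show i + 2 - (i + 1) = 1 by omega]
        omega
      have hne : ((i, i) : ℕ × ℕ) ≠ (i + 2, i + 2) := by simp
      have haL : (i, i) ∈ L.toFinset := by
        rw [List.mem_toFinset, hv.2]
        simp only [Nat.sub_self]
        omega
      have q1 := hout (a := (i, i)) (by simp) o1 (by simp only; omega) (by simp) (by
        simp only [Nat.add_sub_cancel_left]
        omega)
      have q2 := hout (a := (i, i)) (by simp) o2 (by simp) (by simp) (by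
        simp only [Nat.sub_self]
        omega)
      have q3 := hout (a := (i, i)) (by simp) o3 (by simp) (by simp) (by
        simp only [show i + 2 - (i + 1) = 1 by omega]
        omega)
      refine ⟨(i, i), (i + 2, i + 2), hbC, haL, by simp, ?_⟩
      -- If the box before excitation is still in `C`, then `b` was added; otherwise it was moved.
      by_cases haC : (i, i) ∈ C
      · have := Excitation.diagD2 _ i hX' (Finset.mem_insert_self _ _) q1 q2 q3 (houtb hne.symm)
        rwa [hins hne haC] at this
      · have := Excitation.diagD1 _ i hX' (Finset.mem_insert_self _ _) q1 q2 q3 (houtb hne.symm)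
        rwa [hins' hne haC] at this
    · have hs := X.shift_le
      -- The first bound excludes the upper neighbour of `b` from `C`, the second the left
      -- neighbour.
      have w : contentCount X u (q - p + 1) + 2 ≤ p ∧
          (p < q → contentCount X u (q - p - 1) < p) := by
        have u3 := contentCount_le_succ u (q - p - 1)
        unfold UpperFull at hcases hstraight
        simp only at hcases hstraight
        by_cases hpq : p < q
        · simp only [hpq, if_true] at hcases hstraight
          rw [show q - p - 1 + 1 = q - p by omega] at u3
          omega
        · obtain rfl : p = q := by omega
          have hX : X.shift = 0 := by omega
          simp only [lt_irrefl, if_false, hX, if_true, Nat.sub_self, zero_add] at hcases hstraight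
          simp only [Nat.sub_self, zero_add] at hbM u1 u2 ⊢
          omega
      obtain ⟨w1, w2⟩ := w
      obtain ⟨i, rfl⟩ : ∃ i, p = i + 1 := ⟨p - 1, by omega⟩
      obtain ⟨j, rfl⟩ : ∃ j, q = j + 1 := ⟨q - 1, by omega⟩
      simp only [Nat.add_sub_add_right] at *
      have o1 : (i, j + 1) ∉ C := by
        rw [hmem _ (.inl (by simp))]
        simp only [show j + 1 - i = j - i + 1 by omega]
        omega
      have hne : ((i, j) : ℕ × ℕ) ≠ (i + 1, j + 1) := by simp
      have haL : (i, j) ∈ L.toFinset := by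
        rw [List.mem_toFinset, hv.2]
        simp only
        omega
      have q1 := hout (a := (i, j)) (by simp) o1 (by simp only; omega)
        (by simp only; omega) (by
          simp only [show j + 1 - i = j - i + 1 by omega]
          omega)
      refine ⟨(i, j), (i + 1, j + 1), hbC, haL, by simp, ?_⟩
      by_cases hij : i < j
      · have o2 : (i + 1, j) ∉ C := by
          rw [hmem _ (.inr (by simp))]
          simp only [show j - (i + 1) = j - i - 1 by omega]
          omega
        have v3 := contentCount_succ_le v (j - i - 1)
        rw [show j - i - 1 + 1 = j - i by omega] at v3
        have q2 := hout (a := (i, j)) (by simp) o2 (by simp) (by simp only; omega) (by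
          simp only [show j - (i + 1) = j - i - 1 by omega]
          omega)
        by_cases haC : (i, j) ∈ C
        · have := Excitation.offDiag2 (X := X) _ i j hij (Finset.mem_insert_self _ _) q2 q1
            (houtb hne.symm)
          rwa [hins hne haC] at this
        · have := Excitation.offDiag1 (X := X) _ i j hij (Finset.mem_insert_self _ _) q2 q1
            (houtb hne.symm)
          rwa [hins' hne haC] at this
      · obtain rfl : i = j := by omega
        have hX' := BCDType.shift_eq_zero.1 (show X.shift = 0 by omega)
        by_cases haC : (i, i) ∈ C
        · have := Excitation.diagBC2 _ i hX' (Finset.mem_insert_self _ _) q1 (houtb hne.symm)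
          rwa [hins hne haC] at this
        · have := Excitation.diagBC1 _ i hX' (Finset.mem_insert_self _ _) q1 (houtb hne.symm)
          rwa [hins' hne haC] at this

theorem heckeWord_eq_iff_excited {X : BCDType} {n : ℕ} (R : Type*) [CommRing R] [Nontrivial R]
    (hn : X.shift < n) {w v : weylGroup X n} (hw : w ∈ minCosetReps X n)
    (hv : v ∈ minCosetReps X n) {C : Finset (ℕ × ℕ)}
    (hC : C ⊆ shiftedDiagram n (strictPart X v.1)) :
    heckeWord R X n ((readBoxes n (strictPart X v.1)).filter (· ∈ C)) =
      heckeH R (simpleRefls X n) w ↔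
    C ∈ excitedDiagrams X n (strictPart X w.1) (strictPart X v.1) := by
  have hL := readBoxes_pairwise n (strictPart X v.1)
  have hvL := isDiagramOf_readBoxes hv
  have hwL := isDiagramOf_readBoxes hw
  unfold excitedDiagrams shiftedDiagram at *
  generalize readBoxes n (strictPart X v.1) = L at *
  obtain ⟨K, hK⟩ : ∃ K, K = readBoxes n (strictPart X w.1) := ⟨_, rfl⟩
  rw [← hK] at hwL ⊢
  have hKp : K.Pairwise fun a b => BoxLT b a := hK ▸ readBoxes_pairwise n _
  have hdem : ∀ C : Finset (ℕ × ℕ), heckeWord R X n (L.filter (· ∈ C)) =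
      heckeH R (simpleRefls X n) (demWord X n (L.filter (· ∈ C))) := fun C =>
    heckeWord_eq R hn _ fun b hb => hvL.bounds (List.mem_filter.1 hb).1
  have hinj := (signSystem hn).heckeH_injective R
  rw [← simpleRefls_eq] at hinj
  have filter_sorted : ∀ C : Finset (ℕ × ℕ),
      (L.filter (· ∈ C)).Pairwise fun a b => BoxLT b a := fun C => hL.sublist List.filter_sublist
  constructor
  · intro h
    -- Undoing an excitation replaces `b` by a box in a higher row, or just removes `b`, so the sum
    -- of the row numbers drops.
    induction hk : ∑ b ∈ C, b.1 using Nat.strong_induction_on generalizing C with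
    | _ k ih =>
      have hCw : demWord X n (L.filter (· ∈ C)) = w := hinj (by rw [← hdem, h])
      rcases isDiagramOf_or_excitation hL hvL hC L.suffix_refl (by rwa [hCw]) with h1 | h1
      · rw [hCw] at h1
        have e : K.toFinset = C := by
          ext b
          rw [List.mem_toFinset, hwL.2, ← h1.2, List.mem_filter]
          simp only [decide_eq_true_eq]
          exact ⟨fun h => h.2, fun h => ⟨List.mem_toFinset.1 (hC h), h⟩⟩
        rw [e]
        exact ⟨hC, .refl⟩
      · obtain ⟨a, b, hbC, haL, hab, hexc⟩ := h1
        have hC' : insert a (C.erase b) ⊆ L.toFinset :=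
          Finset.insert_subset haL ((Finset.erase_subset _ _).trans hC)
        have hlt : ∑ x ∈ insert a (C.erase b), x.1 < k := by
          have h3 := Finset.add_sum_erase C (fun x => x.1) hbC
          by_cases haC : a ∈ C.erase b
          · rw [Finset.insert_eq_of_mem haC]
            omega
          · rw [Finset.sum_insert haC]
            omega
        obtain ⟨k1, k2⟩ := ih _ hlt hC'
          (by rw [← (heckeWord_excitation R hL hvL hC' hexc).2, h]) rfl
        exact ⟨k1, k2.tail hexc⟩
  · rintro ⟨h1, h2⟩
    have key : C ⊆ L.toFinset ∧ heckeWord R X n (L.filter (· ∈ C)) =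
        heckeWord R X n (L.filter (· ∈ K.toFinset)) := by
      clear hC
      induction h2 with
      | refl => exact ⟨h1, rfl⟩
      | tail _ hexc ih =>
        have := heckeWord_excitation R hL hvL ih.1 hexc
        exact ⟨this.1, this.2.trans ih.2⟩
    rw [key.2, hdem]
    congr 1
    refine demWord_of_isDiagramOf hn (filter_sorted _) ⟨hw, fun b => ?_⟩
    rw [← hwL.2, List.mem_filter]
    simp only [List.mem_toFinset, decide_eq_true_eq, and_iff_right_iff_imp]
    exact fun h => List.mem_toFinset.1 (h1 (List.mem_toFinset.2 h))

/-! ### Roots -/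

/-- The functional attached to the point `y` of `0, …, 2n - 1`. -/
noncomputable def pointEps (n y : ℕ) : Fin n → ℂ := eps n (2 * n) (y + 1)

theorem pointEps_of_lt {n y : ℕ} (h : y < n) : pointEps n y = Pi.single ⟨y, h⟩ 1 := by
  rw [pointEps, eps, if_pos (by omega), epsBasis, dif_pos (by omega)]
  rfl

theorem pointEps_rev {n y : ℕ} (h : y < 2 * n) : pointEps n (2 * n - 1 - y) = -pointEps n y := by
  unfold pointEps eps
  by_cases hy : y < n
  · rw [if_neg (by omega), if_pos (by omega)]
    congr 2
    omega
  · rw [if_pos (by omega), if_neg (by omega), neg_neg]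
    congr 1
    omega

theorem pointEps_dotProduct {n y z : ℕ} (hy : y < 2 * n) (hz : z < 2 * n) :
    pointEps n y ⬝ᵥ pointEps n z =
      if y = z then 1 else if y + z = 2 * n - 1 then -1 else 0 := by
  have key : ∀ {y z : ℕ}, y < n → z < n →
      pointEps n y ⬝ᵥ pointEps n z = if y = z then 1 else 0 := by
    intro y z hy hz
    rw [pointEps_of_lt hy, pointEps_of_lt hz, single_dotProduct, one_mul, Pi.single_apply]
    simp only [Fin.mk.injEq]
  have neg : ∀ {y : ℕ}, y < 2 * n → pointEps n y = -pointEps n (2 * n - 1 - y) := by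
    intro y hy
    rw [pointEps_rev hy, neg_neg]
  by_cases h1 : y < n <;> by_cases h2 : z < n
  · rw [key h1 h2]
    split_ifs <;> first | (exfalso; omega) | rfl
  · rw [neg hz, dotProduct_neg, key h1 (by omega)]
    split_ifs <;> first | (exfalso; omega) | simp
  · rw [neg hy, neg_dotProduct, key (by omega) h2]
    split_ifs <;> first | (exfalso; omega) | simp
  · rw [neg hy, neg hz, neg_dotProduct, dotProduct_neg, neg_neg, key (by omega) (by omega)]
    split_ifs <;> first | (exfalso; omega) | rfl

/-- The factor by which the simple root `α_i` differs from a difference of two points. -/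
noncomputable def rootScale (X : BCDType) (n i : ℕ) : ℂ :=
  match X with
  | .B => if i = n then 2⁻¹ else 1
  | .C => 1
  | .D => 1

theorem rootScale_ne_zero (X : BCDType) (n i : ℕ) : rootScale X n i ≠ 0 := by
  cases X
  · simp only [rootScale]
    split_ifs <;> norm_num
  · exact one_ne_zero
  · exact one_ne_zero

theorem simpleRoot_eq {X : BCDType} {n i : ℕ} (hn : X.shift < n) (hi : 1 ≤ i) (hi' : i ≤ n) :
    simpleRoot X n i =
      rootScale X n i • (pointEps n (lowerIndex X n i) - pointEps n i) := by
  unfold simpleRoot lowerIndex pointEps eps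
  by_cases h : i = n
  · subst h
    have e : 2 * i + 1 - (i + 1) = i := by omega
    have e2 : ¬ i + 1 ≤ i := by omega
    cases X
    · simp only [if_true, BCDType.shift, rootScale, e, e2, if_false, Nat.sub_zero,
        Nat.sub_add_cancel hi, le_refl]
      module
    · simp only [if_true, BCDType.shift, rootScale, e, e2, if_false, Nat.sub_zero,
        Nat.sub_add_cancel hi, le_refl]
      module
    · have hn' : 1 < i := hn
      have e3 : i - 1 - 1 + 1 = i - 1 := by omega
      simp only [if_true, BCDType.shift, rootScale, e, e2, if_false, e3,
        Nat.sub_le]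
      module
  · have hs : rootScale X n i = 1 := by cases X <;> simp [rootScale, h]
    rw [hs, one_smul, if_neg h, if_neg h, if_pos (by omega), if_pos (by omega),
      Nat.sub_add_cancel hi]

theorem reflRoot_add (X : BCDType) (n i : ℕ) (x y : Fin n → ℂ) :
    reflRoot X n i (x + y) = reflRoot X n i x + reflRoot X n i y := by
  unfold reflRoot
  rw [add_dotProduct, mul_add, add_div, add_smul]
  abel

theorem reflRoot_smul (X : BCDType) (n i : ℕ) (c : ℂ) (x : Fin n → ℂ) :
    reflRoot X n i (c • x) = c • reflRoot X n i x := by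
  unfold reflRoot
  rw [smul_dotProduct, smul_eq_mul, smul_sub, smul_smul]
  congr 2
  ring

theorem reflRoot_neg (X : BCDType) (n i : ℕ) (x : Fin n → ℂ) :
    reflRoot X n i (-x) = -reflRoot X n i x := by
  rw [← neg_one_smul ℂ, reflRoot_smul, neg_one_smul]

/-- The reflection along `e_a - e_i` swaps `e_a` and `e_i`, and fixes the points orthogonal to both;
the scalar `rootScale` cancels. -/
theorem reflRoot_pointEps {X : BCDType} {n i y : ℕ} (hn : X.shift < n) (hi : 1 ≤ i)
    (hi' : i ≤ n) (hy : y < 2 * n) :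
    reflRoot X n i (pointEps n y) = pointEps n (simpleVal X n i y) := by
  have hl := lowerIndex_lt hn hi
  have hk := rootScale_ne_zero X n i
  have hrev := simpleVal_rev (X := X) hn hi hi' (x := lowerIndex X n i) (by omega)
  have hrev' := simpleVal_rev (X := X) hn hi hi' (x := i) (by omega)
  have ha := @simpleVal_lower X n i
  have hb := @simpleVal_upper X n i
  have hfix := @simpleVal_of_ne X n i y
  obtain ⟨a, hla⟩ : ∃ a, a = lowerIndex X n i := ⟨_, rfl⟩
  obtain ⟨k, hkk⟩ : ∃ k, k = rootScale X n i := ⟨_, rfl⟩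
  rw [← hla] at hl hrev ha hb hfix
  rw [← hkk] at hk
  have hroot := simpleRoot_eq hn hi hi'
  rw [← hla, ← hkk] at hroot
  -- This is the squared length of `e_a - e_i`: it is `4` if the two points are reversals of each
  -- other, and `2` otherwise.
  have hD : (2 : ℂ) - 2 * (pointEps n a ⬝ᵥ pointEps n i) ≠ 0 := by
    rw [pointEps_dotProduct (by omega) (by omega), if_neg hl.ne]
    split_ifs <;> norm_num
  have hval : ∀ z, z < 2 * n → reflRoot X n i (pointEps n z) = pointEps n z -
      (2 * (pointEps n z ⬝ᵥ pointEps n a - pointEps n z ⬝ᵥ pointEps n i) /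
        (2 - 2 * (pointEps n a ⬝ᵥ pointEps n i))) • (pointEps n a - pointEps n i) := by
    intro z hz
    unfold reflRoot
    rw [hroot, smul_smul]
    congr 2
    simp only [dotProduct_smul, smul_dotProduct, smul_eq_mul, sub_dotProduct, dotProduct_sub]
    rw [dotProduct_comm (pointEps n i) (pointEps n a),
      pointEps_dotProduct (y := a) (z := a) (by omega) (by omega),
      pointEps_dotProduct (y := i) (z := i) (by omega) (by omega), if_pos rfl, if_pos rfl]
    have hD' : k * (k * (1 - pointEps n a ⬝ᵥ pointEps n i) -
        k * (pointEps n a ⬝ᵥ pointEps n i - 1)) ≠ 0 := by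
      convert mul_ne_zero (mul_ne_zero hk hk) hD using 1
      ring
    rw [div_mul_eq_mul_div, div_eq_div_iff hD' hD]
    ring
  have ra : reflRoot X n i (pointEps n a) = pointEps n i := by
    rw [hval a (by omega), pointEps_dotProduct (y := a) (z := a) (by omega) (by omega), if_pos rfl,
      show 2 * (1 - pointEps n a ⬝ᵥ pointEps n i) = 2 - 2 * (pointEps n a ⬝ᵥ pointEps n i) by ring,
      div_self hD, one_smul, sub_sub_cancel]
  have ri : reflRoot X n i (pointEps n i) = pointEps n a := by
    rw [hval i (by omega), pointEps_dotProduct (y := i) (z := i) (by omega) (by omega), if_pos rfl,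
      dotProduct_comm (pointEps n i) (pointEps n a),
      show 2 * (pointEps n a ⬝ᵥ pointEps n i - 1) =
        -(2 - 2 * (pointEps n a ⬝ᵥ pointEps n i)) by ring, neg_div, div_self hD]
    module
  by_cases h1 : y = a
  · rw [h1, ra, ha]
  by_cases h2 : y = i
  · rw [h2, ri, hb]
  by_cases h3 : y = 2 * n - 1 - a
  · rw [h3, hrev, ha, pointEps_rev (by omega), pointEps_rev (by omega), reflRoot_neg, ra]
  by_cases h4 : y = 2 * n - 1 - i
  · rw [h4, hrev', hb, pointEps_rev (by omega), pointEps_rev (by omega), reflRoot_neg, ri]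
  rw [hfix h1 h2 h3 h4, hval y hy, pointEps_dotProduct hy (by omega),
    pointEps_dotProduct hy (by omega), if_neg h1, if_neg h2, if_neg (by omega), if_neg (by omega)]
  simp

theorem foldr_reflRoot {X : BCDType} {n : ℕ} (hn : X.shift < n) (L : List ℕ)
    (hL : ∀ i ∈ L, 1 ≤ i ∧ i ≤ n) (k : ℂ) (x y : Fin (2 * n)) :
    L.foldr (reflRoot X n) (k • (pointEps n x + pointEps n y)) =
      k • (pointEps n ((L.map (simpleRefl X n)).prod.1 x) +
        pointEps n ((L.map (simpleRefl X n)).prod.1 y)) := by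
  induction L with
  | nil => rfl
  | cons i L ih =>
    obtain ⟨h1, h2⟩ := hL i (by simp)
    rw [List.foldr_cons, ih fun i hi => hL i (by simp [hi]), reflRoot_smul, reflRoot_add,
      reflRoot_pointEps hn h1 h2 (Fin.is_lt _), reflRoot_pointEps hn h1 h2 (Fin.is_lt _),
      List.map_cons, List.prod_cons, simpleRefl_mul_val hn h1 h2, simpleRefl_mul_val hn h1 h2]

theorem oneLine_add {n k : ℕ} (v : Equiv.Perm (Fin (2 * n))) (z : Fin (2 * n))
    (hz : (z : ℕ) + 1 = k) : oneLine v k = v z + 1 := by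
  have := z.2
  rw [oneLine, dif_pos (by omega)]
  congr 3
  apply Fin.ext
  simp only
  omega

theorem eps_oneLineOdd {n k : ℕ} (v : Equiv.Perm (Fin (2 * n))) (z : Fin (2 * n)) (hk : n < k)
    (hz : (z : ℕ) + 1 = k) : eps n (2 * n + 1) (oneLineOdd v (k + 1)) = pointEps n (v z) := by
  unfold oneLineOdd
  rw [if_neg (by omega), if_neg (by omega), Nat.add_sub_cancel, oneLine_add v z hz]
  unfold pointEps eps
  have := (v z).2
  by_cases h : (v z : ℕ) + 1 ≤ n
  · simp only [h, if_true]
  · simp only [h, if_false]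
    rw [if_neg (by omega)]
    congr 2
    omega

theorem rootOfBox_eq {X : BCDType} {n : ℕ} (v : weylGroup X n) {p q : ℕ} (hp : 1 ≤ p)
    (hpq : p ≤ q) (hd : q - p + X.shift < n) (z₁ z₂ : Fin (2 * n)) (h₁ : (z₁ : ℕ) + 1 = n + p)
    (h₂ : (z₂ : ℕ) + 1 = n + q + X.shift) : rootOfBox X v (p, q) =
      rootScale X n (tabEntry X n (p, q)) • (pointEps n (v.1 z₁) + pointEps n (v.1 z₂)) := by
  cases X
  · simp only [BCDType.shift, add_zero] at h₂ hd
    simp only [rootOfBox, rootScale]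
    rw [eps_oneLineOdd _ z₁ (by omega) h₁, eps_oneLineOdd _ z₂ (by omega) h₂, tabEntry]
    have e : n + p - q = n ↔ p = q := by omega
    simp only [e]
  · simp only [BCDType.shift, add_zero] at h₂
    simp only [rootOfBox, rootScale]
    rw [oneLine_add _ z₁ h₁, oneLine_add _ z₂ h₂, one_smul]
    rfl
  · simp only [BCDType.shift] at h₂
    simp only [rootOfBox, rootScale]
    rw [oneLine_add _ z₁ h₁, oneLine_add _ z₂ h₂, one_smul]
    rfl

/-- With `u` the product over `b :: M`, the simple root of `b` is a multiple of `e_x + e_y`, where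
`x` is the lower point and `y` the reversal of the label. Adding `b` has turned both into values at
the second half of the positions of `u`, and their positions there are given by head counts. -/
theorem foldr_reflRoot_eq_rootOfBox {X : BCDType} {n : ℕ} {K M : List (ℕ × ℕ)} {b : ℕ × ℕ}
    {v : weylGroup X n} (hL : (K ++ b :: M).Pairwise fun a b => BoxLT b a)
    (hv : IsDiagramOf X (K ++ b :: M) v) :
    (K.map (tabEntry X n)).foldr (reflRoot X n) (simpleRoot X n (tabEntry X n b)) =
      rootOfBox X v b := by
  have hbd : ∀ x ∈ K ++ b :: M, 1 ≤ tabEntry X n x ∧ tabEntry X n x ≤ n := by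
    intro x hx
    have := hv.bounds hx
    have h := tabEntry_bounds this.1 this.2
    exact ⟨h.1, h.2.1⟩
  have hbL : b ∈ K ++ b :: M := by simp
  have hb := hv.bounds hbL
  have hn : X.shift < n := by omega
  have hsuf : b :: M <:+ K ++ b :: M := List.suffix_append _ _
  obtain ⟨d1, d2, -⟩ := isDiagramOf_suffix hL hv hsuf
  obtain ⟨e1, -, -⟩ := isDiagramOf_suffix hL hv ((List.suffix_cons b M).trans hsuf)
  have hvprod : v = (K.map (boxRefl X n)).prod * demWord X n (b :: M) := by
    rw [d2, ← List.prod_append, ← List.map_append,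
      ← (isDiagramOf_suffix hL hv (List.suffix_refl _)).2.1, demWord_of_isDiagramOf hn hL hv]
  have hcount : contentCount X (demWord X n (b :: M)) (b.2 - b.1) = b.1 := by
    have h1 := (d1.2 b).1 (by simp)
    have h2 := (d1.2 (b.1 + 1, b.2 + 1)).not.1 (by
      rw [List.mem_cons, mem_tail_iff hL hsuf]
      rintro (h | h)
      · have := congrArg Prod.fst h
        simp at this
      · have := h.2
        unfold BoxLT at this
        simp only at this
        omega)
    simp only [Nat.add_sub_add_right] at h2
    omega
  have hcases := demL_cases (u := demWord X n M) hb.1 hb.2 (by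
    rw [← demWord_cons]
    exact d1.1)
  have hbM : b ∉ M := by
    rw [mem_tail_iff hL hsuf]
    unfold BoxLT
    omega
  have hstep : contentCount X (demWord X n M) (b.2 - b.1) =
        contentCount X (demWord X n M) (b.2 - b.1 + 1) ∧
      ¬ UpperFull X (contentCount X (demWord X n M)) b := by
    rcases hcases.2 with h | h
    · exact h
    · exfalso
      have h3 := (d1.2 b).1 (by simp)
      rw [demWord_cons, h.2.2, ← e1.2] at h3
      exact hbM h3
  have hb1 := ((hv.2 b).1 hbL).1
  obtain ⟨-, hmul, -, -⟩ := e1.cons hb1 hb.1 hb.2 hstep.1 hstep.2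
  rw [← demWord_cons] at hmul
  obtain ⟨p, q⟩ := b
  simp only at *
  obtain ⟨b1, b2, b3⟩ := tabEntry_bounds hb.1 hb.2
  rw [← isHead_lower_iff hb.1 hb.2, ← isHead_upper_iff hb.1 hb.2] at hstep
  obtain ⟨u, hu⟩ : ∃ u, u = demWord X n ((p, q) :: M) := ⟨_, rfl⟩
  rw [← hu] at d1 hvprod hcount hmul
  have hhead := isHead_mul hn b1 b2 (demWord X n M)
  rw [← boxRefl, ← hmul] at hhead
  have n1 : ¬ IsHead u.1 (lowerIndex X n (tabEntry X n (p, q))) := by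
    rw [hhead, simpleVal_lower]
    exact hstep.2
  have r1 := isHead_rev hn u (t := 2 * n - 1 - tabEntry X n (p, q)) (t' := tabEntry X n (p, q))
    (by omega)
  have n2 : IsHead u.1 (tabEntry X n (p, q)) := by
    rw [hhead, simpleVal_upper]
    exact hstep.1
  have n3 : ¬ IsHead u.1 (2 * n - 1 - tabEntry X n (p, q)) := mt r1.1 (not_not.2 n2)
  have hlow := lowerIndex_lt hn b1
  obtain ⟨z₁, hz₁⟩ := u.1.surjective ⟨lowerIndex X n (tabEntry X n (p, q)), by omega⟩
  obtain ⟨z₂, hz₂⟩ := u.1.surjective ⟨2 * n - 1 - tabEntry X n (p, q), by omega⟩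
  have p1 := inv_apply_of_not_isHead hn d1.1 z₁ (y := lowerIndex X n (tabEntry X n (p, q)))
    (congrArg Fin.val hz₁) n1
  have p2 := inv_apply_of_not_isHead hn d1.1 z₂ (y := 2 * n - 1 - tabEntry X n (p, q))
    (congrArg Fin.val hz₂) n3
  have c1 : headCount u.1 (n + (q - p) + X.shift) = p := hcount
  rw [b3, show 2 * n - 1 - (n - 1 - (q - p) - X.shift) = n + (q - p) + X.shift by omega, c1] at p1
  rw [show 2 * n - 1 - (2 * n - 1 - tabEntry X n (p, q)) = tabEntry X n (p, q) by omega] at p2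
  have c2 : headCount u.1 (tabEntry X n (p, q)) = q + X.shift := by
    have hcompl := headCount_compl hn u (k := q - p + X.shift) (by omega)
    rw [← add_assoc n, c1] at hcompl
    -- Only in this case does the label differ from `n - (q - p + X.shift)`: it is `n`, a head,
    -- which contributes the extra one.
    by_cases hd : p = q ∧ X.shift = 1 ∧ Odd p
    · obtain ⟨rfl, hX, ho⟩ := hd
      have e := tabEntry_diag (n := n) (p := p) hX
      rw [if_pos ho] at e
      rw [e] at n2 ⊢
      rw [headCount_of_isHead n2]
      rw [hX, Nat.sub_self, add_zero] at c1
      omega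
    · have e : tabEntry X n (p, q) = n - (q - p + X.shift) := by
        by_cases h : p < q ∨ p = q ∧ X.shift = 0
        · rw [tabEntry_eq h]
          omega
        · have hs := X.shift_le
          obtain rfl : p = q := by omega
          have hX : X.shift = 1 := by omega
          rw [tabEntry_diag hX, if_neg (fun ho => hd ⟨rfl, hX, ho⟩)]
          omega
      rw [e]
      omega
  rw [c2] at p2
  rw [rootOfBox_eq v hb1 hb.1 hb.2 z₁ z₂ p1 (by omega), simpleRoot_eq hn b1 b2, sub_eq_add_neg,
    ← pointEps_rev (by omega)]
  have f1 : (⟨lowerIndex X n (tabEntry X n (p, q)), by omega⟩ : Fin (2 * n)) = u.1 z₁ := hz₁.symm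
  have hfold := foldr_reflRoot hn (K.map (tabEntry X n)) (by
    intro i hi
    obtain ⟨x, hx, rfl⟩ := List.mem_map.1 hi
    exact hbd x (by simp [hx])) (rootScale X n (tabEntry X n (p, q))) (u.1 z₁) (u.1 z₂)
  rw [hz₁, hz₂] at hfold
  rw [hfold, ← hz₁, ← hz₂, List.map_map, hvprod]
  rfl

/-! ### The sequence read from the tableau -/

theorem ofFn_word {X : BCDType} {n : ℕ} (v : weylGroup X n) :
    List.ofFn (word X v) = (readBoxes n (strictPart X v.1)).map (boxRefl X n) := by
  conv_rhs => rw [← List.ofFn_get (readBoxes n (strictPart X v.1)), List.map_ofFn]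
  rfl

theorem ofFn_wordIdx {X : BCDType} {n : ℕ} (v : weylGroup X n) :
    List.ofFn (wordIdx X v) = (readBoxes n (strictPart X v.1)).map (tabEntry X n) := by
  conv_rhs => rw [← List.ofFn_get (readBoxes n (strictPart X v.1)), List.map_ofFn]
  rfl

theorem heckeSubword_subwordOf {X : BCDType} {n : ℕ} (R : Type*) [CommRing R]
    (v : weylGroup X n) (C : Finset (ℕ × ℕ)) :
    heckeSubword R (simpleRefls X n) (word X v) (subwordOf X v C) =
      heckeWord R X n ((readBoxes n (strictPart X v.1)).filter (· ∈ C)) := by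
  unfold heckeSubword heckeWord
  congr 1
  conv_rhs =>
    rw [← List.map_get_finRange (readBoxes n (strictPart X v.1)), List.filter_map, List.map_map]
  simp only [subwordOf, Finset.mem_filter, Finset.mem_univ, true_and]
  rfl

/-- No box occurs twice in the reading word, so sets of positions correspond to sets of boxes. -/
theorem exists_eq_subwordOf {X : BCDType} {n : ℕ} (v : weylGroup X n)
    (t : Finset (Fin (wordLen X v))) :
    ∃ C ⊆ shiftedDiagram n (strictPart X v.1), t = subwordOf X v C := by
  refine ⟨t.image (wordBox X v), ?_, ?_⟩
  · intro b hb
    obtain ⟨c, -, rfl⟩ := Finset.mem_image.1 hb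
    exact List.mem_toFinset.2 (List.get_mem _ _)
  · ext c
    have hinj : Function.Injective (wordBox X v) :=
      List.nodup_iff_injective_get.1 (readBoxes_nodup _ _)
    simp only [subwordOf, Finset.mem_filter, Finset.mem_univ, true_and,
      hinj.mem_finset_image]

theorem rootSeq_eq {X : BCDType} {n : ℕ} {v : weylGroup X n} (hv : v ∈ minCosetReps X n)
    (c : Fin (wordLen X v)) :
    rootSeq X n (wordIdx X v) c = rootOfBox X v (wordBox X v c) := by
  have hL := readBoxes_pairwise n (strictPart X v.1)
  have hvL := isDiagramOf_readBoxes hv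
  have e : readBoxes n (strictPart X v.1) = (readBoxes n (strictPart X v.1)).take c ++
      wordBox X v c :: (readBoxes n (strictPart X v.1)).drop (c + 1) := by
    conv_lhs => rw [← List.take_append_drop c (readBoxes n (strictPart X v.1)),
      List.drop_eq_getElem_cons c.2]
    rfl
  rw [e] at hL hvL
  unfold rootSeq
  rw [ofFn_wordIdx, ← List.map_take]
  exact foldr_reflRoot_eq_rootOfBox hL hvL

/-! ### The trivial Weyl groups -/

theorem subsingleton_weylGroup {X : BCDType} {n : ℕ} (hn : ¬ X.shift < n) :
    Subsingleton (weylGroup X n) := by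
  have hs := X.shift_le
  rcases Nat.eq_zero_or_pos n with rfl | hpos
  · have : Subsingleton (Equiv.Perm (Fin (2 * 0))) := inferInstanceAs
      (Subsingleton (Equiv.Perm (Fin 0)))
    infer_instance
  · obtain rfl : n = 1 := by omega
    obtain rfl := BCDType.shift_eq_one.1 (show X.shift = 1 by omega)
    -- The transpositions `(0, 1)` and `(2, 3)` are out of range and equal `1` by default, so the
    -- two copies of `(1, 2)` cancel.
    have h1 : simplePerm .D 1 1 = 1 := by decide
    have : weylGroup .D 1 = ⊥ := by
      rw [weylGroup, Subgroup.closure_eq_bot_iff]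
      rintro _ ⟨i, ⟨hi1, hi2⟩, rfl⟩
      obtain rfl : i = 1 := by omega
      exact h1
    rw [this]
    infer_instance

theorem readBoxes_eq_nil {X : BCDType} {n : ℕ} (hn : ¬ X.shift < n)
    (u : Equiv.Perm (Fin (2 * n))) : readBoxes n (strictPart X u) = [] := by
  rw [List.eq_nil_iff_forall_not_mem]
  intro b hb
  obtain ⟨h1, h2, h3, h4⟩ := mem_readBoxes.1 hb
  have hs := X.shift_le
  rw [lt_strictPart_iff h1 h2] at h4
  have := (u ⟨n - b.1, by omega⟩).2
  omega

theorem excitedDiagrams_subset {X : BCDType} {n : ℕ} {lam μ : ℕ → ℕ} {C : Finset (ℕ × ℕ)}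
    (h : C ∈ excitedDiagrams X n lam μ) : C ⊆ shiftedDiagram n μ := by
  obtain ⟨h1, h2⟩ := h
  induction h2 with
  | refl => exact h1
  | tail _ hexc ih =>
    obtain ⟨a, b, -, hb, -, -, -, -, -, h⟩ := hexc.spec (n := n) fun b hb =>
      (mem_readBoxes.1 (List.mem_toFinset.1 hb)).2.2.1
    rcases h with rfl | rfl
    · exact Finset.insert_subset hb ((Finset.erase_subset _ _).trans ih)
    · exact Finset.insert_subset hb ih

theorem proposition5p6 (X : BCDType) (n : ℕ) (R : Type*) [CommRing R] [Nontrivial R]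
    (w v : weylGroup X n) (hw : w ∈ minCosetReps X n) (hv : v ∈ minCosetReps X n) :
    -- the sequence read from the tableau is a reduced decomposition of `v`
    ((List.ofFn (word X v)).prod = v ∧ genLength (simpleRefls X n) v = wordLen X v) ∧
    -- its subsequences with 0-Hecke product `H_w` correspond to subsets of `D'_μ`
    heckeSubwords R (simpleRefls X n) w (word X v) =
      {t | ∃ C ⊆ shiftedDiagram n (strictPart X v.1), t = subwordOf X v C ∧
        heckeSubword R (simpleRefls X n) (word X v) (subwordOf X v C) =
          heckeH R (simpleRefls X n) w} ∧
    -- (i)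
    heckeSubwords R (simpleRefls X n) w (word X v) =
      {t | ∃ C ∈ excitedDiagrams X n (strictPart X w.1) (strictPart X v.1),
        t = subwordOf X v C} ∧
    -- (ii)
    ∀ c : Fin (wordLen X v), rootSeq X n (wordIdx X v) c = rootOfBox X v (wordBox X v c) := by
  have h2 : heckeSubwords R (simpleRefls X n) w (word X v) =
      {t | ∃ C ⊆ shiftedDiagram n (strictPart X v.1), t = subwordOf X v C ∧
        heckeSubword R (simpleRefls X n) (word X v) (subwordOf X v C) =
          heckeH R (simpleRefls X n) w} := by
    ext t
    constructor
    · intro ht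
      obtain ⟨C, hC, rfl⟩ := exists_eq_subwordOf v t
      exact ⟨C, hC, rfl, ht⟩
    · rintro ⟨C, -, rfl, h⟩
      exact h
  by_cases hn : X.shift < n
  · have hL := readBoxes_pairwise n (strictPart X v.1)
    have hvL := isDiagramOf_readBoxes hv
    obtain ⟨-, hprod, hlen⟩ := isDiagramOf_suffix hL hvL (List.suffix_refl _)
    rw [demWord_of_isDiagramOf hn hL hvL] at hprod hlen
    refine ⟨⟨by rw [ofFn_word, ← hprod], hlen⟩, h2, ?_, rootSeq_eq hv⟩
    rw [h2]
    ext t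
    constructor
    · rintro ⟨C, hC, rfl, h⟩
      rw [heckeSubword_subwordOf] at h
      exact ⟨C, (heckeWord_eq_iff_excited R hn hw hv hC).1 h, rfl⟩
    · rintro ⟨C, hC, rfl⟩
      have hCD := excitedDiagrams_subset hC
      refine ⟨C, hCD, rfl, ?_⟩
      rw [heckeSubword_subwordOf]
      exact (heckeWord_eq_iff_excited R hn hw hv hCD).2 hC
  -- The remaining ranks are `n = 0`, and `n = 1` in type D, where the group is trivial and the word
  -- is empty.
  · have := subsingleton_weylGroup hn
    have hnil := readBoxes_eq_nil hn
    have hlen : wordLen X v = 0 := by rw [wordLen, hnil, List.length_nil]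
    have hempty : IsEmpty (Fin (wordLen X v)) := by
      rw [hlen]
      infer_instance
    have hv1 : v = 1 := Subsingleton.elim _ _
    have hw1 : w = 1 := Subsingleton.elim _ _
    refine ⟨⟨Subsingleton.elim _ _, ?_⟩, h2, ?_, fun c => hempty.elim c⟩
    · rw [hlen, hv1, genLength_one]
    · ext t
      constructor
      · intro _
        refine ⟨shiftedDiagram n (strictPart X w.1), ⟨?_, .refl⟩, Subsingleton.elim _ _⟩
        rw [hw1, hv1]
      · rintro ⟨C, -, rfl⟩
        change heckeSubword R (simpleRefls X n) (word X v) (subwordOf X v C) = _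
        rw [heckeSubword_subwordOf, hnil, hw1, heckeH_one]
        rfl
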